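/- Let $\mathbb{T}=\mathbb{R}/2\pi\mathbb{Z}$ be the unit circle (parametrized by the angle) and let $\mu$ be a finite positive Borel measure on $\mathbb{T}$ that is singular with respect to arc length. Let $$S_\mu(z)=\exp\Big\{-\int_{\mathbb{T}}\frac{e^{i\theta}+z}{e^{i\theta}-z}\,d\mu(\theta)\Big\},\qquad |z|<1,$$ be the associated singular inner function, and let $$\omega_\mu(t)=\sup\{|\mu(I)-\mu(J)| : I,J\subset\mathbb{T}\text{ adjacent arcs},\ |I|=|J|\le t\}$$ be the modulus of smoothness of $\mu$. Suppose that there is a constant $C>0$ such that $$\omega_\mu(t)\le C\,\frac{t}{\sqrt{\log(e/t)}}\qquad\text{for all }t\in(0,1).$$ Then, for every real $p>2$, $S_\mu$ is a multiplier of the Besov space $D^p_{p-1}$, that is, $S_\mu f\in D^p_{p-1}$ for every $f\in D^p_{p-1}$. Here $D^p_{p-1}$ is the space of all holomorphic functions $f$ on the unit disc $\mathbb{D}$ such that $$|f(0)|+\Big(\int_{\mathbb{D}}(1-|z|)^{p-1}|f'(z)|^p\,dA(z)\Big)^{1/p}<\infty,$$ where $dA$ is area measure. -/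

import Mathlib

open MeasureTheory

noncomputable section

namespace BesovMultiplier

/-- The circle `𝕋`, parametrized by the angle: `ℝ / 2πℤ`.  Mathlib's `volume` on it is arc
length (Lebesgue measure, of total mass `2π`). -/
abbrev Torus : Type := AddCircle (2 * Real.pi)

instance factTwoPiPos : Fact (0 < 2 * Real.pi) := ⟨Real.two_pi_pos⟩

/-- The half-open arc of `𝕋` of length `h` (for `0 < h ≤ 2π`) that starts at the angle `a`. -/
def arc (a h : ℝ) : Set Torus := (fun x : ℝ => (x : Torus)) '' Set.Ico a (a + h)

/-- The modulus of smoothness of a positive measure on `𝕋`: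
`ω_μ(t) = sup { |μ(I) - μ(J)| : I, J adjacent arcs, |I| = |J| ≤ t }`.
For a finite measure and `t > 0` the set is non-empty and bounded above by `μ(𝕋)`.
The bound `h ≤ π` says that the two adjacent arcs are disjoint; it is automatic for `t < 1`. -/
def modulusOfSmoothness (μ : Measure Torus) (t : ℝ) : ℝ :=
  sSup {d : ℝ | ∃ a h : ℝ, 0 < h ∧ h ≤ t ∧ h ≤ Real.pi ∧
    d = |μ.real (arc a h) - μ.real (arc (a + h) h)|}

/-- The singular inner function of `μ`,
`S_μ(z) = exp (-∫ (e^{iθ} + z) / (e^{iθ} - z) dμ(θ))`, for `|z| < 1`. -/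
def singularInner (μ : Measure Torus) (z : ℂ) : ℂ :=
  Complex.exp (-∫ θ : Torus,
    ((AddCircle.toCircle θ : ℂ) + z) / ((AddCircle.toCircle θ : ℂ) - z) ∂μ)

/-- The norm `|f(0)| + (∫_𝔻 (1 - |z|)^{p-1} |f'(z)|^p dA(z))^{1/p}`, with values in `[0, ∞]`. -/
def besovNorm (p : ℝ) (f : ℂ → ℂ) : ENNReal :=
  ENNReal.ofReal ‖f 0‖ +
    (∫⁻ z in Metric.ball (0 : ℂ) 1,
      ENNReal.ofReal ((1 - ‖z‖) ^ (p - 1) * ‖deriv f z‖ ^ p)) ^ (1 / p)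

/-- The Besov space `D^p_{p-1}` of the functions that are holomorphic on the open unit disc and
have finite norm.  Membership depends only on the restriction of `f` to the open unit disc. -/
def besovSpace (p : ℝ) : Set (ℂ → ℂ) :=
  {f | DifferentiableOn ℂ f (Metric.ball (0 : ℂ) 1) ∧ besovNorm p f < ⊤}

/-- `h` is a multiplier of the function space `X`: `h f ∈ X` whenever `f ∈ X`. -/
def IsMultiplier (X : Set (ℂ → ℂ)) (h : ℂ → ℂ) : Prop :=
  ∀ f ∈ X, (fun z => h z * f z) ∈ X

end BesovMultiplier

end

/-! The proof has two independent halves, joined by the product rule. Write `h = 1 - |z|` and `L(h)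
= log (e / h)`, and let `H` be the Herglotz integral of `μ`, so that `S_μ = exp (-H)`.

The first half is the pointwise bound `|H'(z)| ≤ K / (h √L(h))` (`exists_norm_herglotzDeriv_le`). Up
to sign, `Im (z H'(z))` is the angular derivative of the Poisson integral of `μ`. The derivative of
the Poisson kernel is odd and vanishes at `π`, so Fubini turns this into an integral of the second
derivative of the kernel against the differences of `μ` over adjacent arcs (`im_mul_herglotzDeriv`).
The smoothness hypothesis and the slow variation of `L` then bound the imaginary part.
Borel–Carathéodory on discs of radius `h / 2` bounds the derivative of `z H'(z)`, and radial
integration recovers `z H'(z)` itself. Since `Re H ≥ 0`, `|S_μ| ≤ 1` and `|S_μ'| ≤ |H'|`.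

In `(S f)' = S' f + S f'` the second term is harmless. With `p = 2q`, the first one requires that
`|f|^p` be integrable against `h^(p-1) (h √L)^(-p) = h⁻¹ L^(-q)`. This is the Hardy type inequality
`exists_setIntegral_regPow_le`, the second half. Because `q > 1`, the weight has the primitive
`L^(1-q) / (q-1)`, which vanishes at the boundary. Two radial integrations by parts move the weight
onto the Laplacian of `(1 + |f|²)^q`, which is at most a multiple of `(1 + |f|²)^(q-1) |f'|²`;
Young's inequality splits this into a part absorbed on the left and the Besov integrand. The summand
`1` keeps the powers smooth at zeros of `f`, and working on `|z| ≤ R < 1` keeps the absorbed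
integral finite. -/

noncomputable section

namespace BesovMultiplier

/-! ### The logarithmic weight -/

/-- The weight `log (e / h)`. -/
def logWeight (h : ℝ) : ℝ := 1 - Real.log h

theorem one_le_logWeight {h : ℝ} (h0 : 0 < h) (h1 : h ≤ 1) : 1 ≤ logWeight h := by
  have := Real.log_nonpos h0.le h1
  unfold logWeight; linarith

theorem logWeight_pos {h : ℝ} (h0 : 0 < h) (h1 : h ≤ 1) : 0 < logWeight h :=
  zero_lt_one.trans_le (one_le_logWeight h0 h1)

theorem log_exp_one_div {h : ℝ} (h0 : 0 < h) : Real.log (Real.exp 1 / h) = logWeight h := by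
  rw [Real.log_div (Real.exp_pos 1).ne' h0.ne', Real.log_exp, logWeight]

theorem hasDerivAt_logWeight {h : ℝ} (h0 : h ≠ 0) : HasDerivAt logWeight (-h⁻¹) h :=
  (Real.hasDerivAt_log h0).const_sub 1

theorem logWeight_anti {a b : ℝ} (ha : 0 < a) (hab : a ≤ b) : logWeight b ≤ logWeight a := by
  have := Real.log_le_log ha hab
  unfold logWeight; linarith

/-- Slow variation of the square root of the logarithmic weight. -/
theorem sqrt_logWeight_le {h t : ℝ} (h0 : 0 < h) (t0 : 0 < t) (t1 : t ≤ 1) :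
    √(logWeight h) ≤ (1 + t / h) * √(logWeight t) := by
  have hlt := one_le_logWeight t0 t1
  have hx : 0 < t / h := div_pos t0 h0
  -- `L(h) = L(t) + log (t / h)` and `log x ≤ x - 1`; then `L(t) ≥ 1` lets `t / h` be multiplied by
  -- `L(t)`.
  have key : logWeight h ≤ logWeight t * (1 + t / h) := by
    have h2 : logWeight h = logWeight t + Real.log (t / h) := by
      rw [Real.log_div t0.ne' h0.ne']; unfold logWeight; ring
    have h3 := Real.log_le_sub_one_of_pos hx
    nlinarith
  calc √(logWeight h) ≤ √((1 + t / h) ^ 2 * logWeight t) := by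
        apply Real.sqrt_le_sqrt
        nlinarith [mul_pos hx (zero_lt_one.trans_le hlt)]
    _ = (1 + t / h) * √(logWeight t) := by
        rw [Real.sqrt_mul (by positivity), Real.sqrt_sq (by positivity)]

/-- A crude bound for the ranges where the modulus of smoothness is not needed: long arcs, and
points far from the circle. -/
theorem sqrt_logWeight_le_inv {h : ℝ} (h0 : 0 < h) (h1 : h ≤ 1) : √(logWeight h) ≤ h⁻¹ := by
  have h2 := one_le_logWeight h0 h1
  have h3 := Real.log_le_sub_one_of_pos (inv_pos.2 h0)
  rw [Real.log_inv] at h3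
  calc √(logWeight h) ≤ logWeight h := Real.sqrt_le_self_iff.2 (Or.inr h2) 
    _ ≤ h⁻¹ := by unfold logWeight; linarith

/-! ### The Poisson kernel and its angular derivatives -/

/-- The denominator `|e^{is} - r|²` of the Poisson kernel. -/
def poissonDenom (r s : ℝ) : ℝ := 1 - 2 * r * Real.cos s + r ^ 2

theorem sq_le_poissonDenom {r : ℝ} (h0 : 0 ≤ r) (s : ℝ) : (1 - r) ^ 2 ≤ poissonDenom r s := by
  have := Real.cos_le_one s
  unfold poissonDenom; nlinarith

/-- For `r ≤ 1/2` the denominator is at least `1/4`, while `s² ≤ π² < 10`. For `r ≥ 1/2` it equals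
`(1 - r)² + 2r (1 - cos s)`, and `1 - cos s ≥ 2s² / π²`. -/
theorem sq_add_sq_le_poissonDenom {r s : ℝ} (h0 : 0 ≤ r) (h1 : r < 1) (hs : |s| ≤ Real.pi) :
    (1 - r) ^ 2 + s ^ 2 ≤ 41 * poissonDenom r s := by
  have hD := sq_le_poissonDenom h0 s
  suffices s ^ 2 ≤ 40 * poissonDenom r s by linarith
  have hpi := Real.pi_lt_d2
  have hpi0 := Real.pi_pos
  have hs2 : s ^ 2 ≤ Real.pi ^ 2 := by
    rw [← sq_abs s]; gcongr
  rcases le_total r (1 / 2) with hr | hr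
  · nlinarith
  · have hc := Real.cos_le_one_sub_mul_cos_sq hs
    have hp : (1 / 10 : ℝ) ≤ 1 / Real.pi ^ 2 := by
      apply one_div_le_one_div_of_le (by positivity)
      nlinarith
    have hc' : s ^ 2 / 5 ≤ 1 - Real.cos s := by
      have : s ^ 2 * (1 / 10) ≤ s ^ 2 * (1 / Real.pi ^ 2) := by gcongr
      have e : 2 / Real.pi ^ 2 * s ^ 2 = 2 * (s ^ 2 * (1 / Real.pi ^ 2)) := by ring
      linarith
    unfold poissonDenom
    nlinarith [mul_le_mul hr hc' (by positivity) h0, sq_nonneg (1 - r)]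

/-- The angular derivative of the Poisson kernel. -/
def poissonDeriv (r s : ℝ) : ℝ :=
  -(2 * r * (1 - r ^ 2) * Real.sin s) / poissonDenom r s ^ 2

/-- The second angular derivative of the Poisson kernel. -/
def poissonDeriv₂ (r s : ℝ) : ℝ :=
  (1 - r ^ 2) * (8 * r ^ 2 * Real.sin s ^ 2 / poissonDenom r s ^ 3 -
    2 * r * Real.cos s / poissonDenom r s ^ 2)

theorem poissonDenom_pos {r : ℝ} (h0 : 0 ≤ r) (h1 : r < 1) (s : ℝ) : 0 < poissonDenom r s :=
  (pow_pos (sub_pos.2 h1) 2).trans_le (sq_le_poissonDenom h0 s)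

theorem hasDerivAt_poissonDeriv {r : ℝ} (h0 : 0 ≤ r) (h1 : r < 1) (s : ℝ) :
    HasDerivAt (poissonDeriv r) (poissonDeriv₂ r s) s := by
  have hD := poissonDenom_pos h0 h1 s
  have e : HasDerivAt (poissonDenom r) (2 * r * Real.sin s) s := by
    have := (((Real.hasDerivAt_cos s).const_mul (2 * r)).const_sub 1).add_const (r ^ 2)
    convert! this using 1; ring
  have := (((Real.hasDerivAt_sin s).const_mul (2 * r * (1 - r ^ 2))).neg).div (e.pow 2)
    (pow_pos hD 2).ne'
  convert! this using 1
  unfold poissonDeriv₂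
  simp only [Pi.pow_apply, Pi.neg_apply]
  field_simp
  ring

theorem continuous_poissonDeriv₂ {r : ℝ} (h0 : 0 ≤ r) (h1 : r < 1) :
    Continuous (poissonDeriv₂ r) := by
  have hD : ∀ s, poissonDenom r s ≠ 0 := fun s => (poissonDenom_pos h0 h1 s).ne'
  have hc : Continuous (poissonDenom r) := by unfold poissonDenom; fun_prop
  unfold poissonDeriv₂
  refine continuous_const.mul (.sub (.div ?_ (hc.pow 3) fun s => pow_ne_zero 3 (hD s))
    (.div ?_ (hc.pow 2) fun s => pow_ne_zero 2 (hD s))) <;> fun_prop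

/-- Both terms are `O(D⁻²)`, with `D` the Poisson denominator, because `D = (1 - r cos s)² + r² sin²
s` dominates `r² sin² s`. The constant is `2 · 10 · 41² = 33620`, rounded up. -/
theorem abs_poissonDeriv₂_le {r s : ℝ} (h0 : 0 ≤ r) (h1 : r < 1) (hs : |s| ≤ Real.pi) :
    |poissonDeriv₂ r s| ≤ 40000 * (1 - r) / ((1 - r) ^ 2 + s ^ 2) ^ 2 := by
  have hD := poissonDenom_pos h0 h1 s
  have hE := sq_add_sq_le_poissonDenom h0 h1 hs
  have hE0 : 0 < (1 - r) ^ 2 + s ^ 2 := by have := sub_pos.2 h1; positivity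
  have hsin : r ^ 2 * Real.sin s ^ 2 ≤ poissonDenom r s := by
    have := Real.sin_sq_add_cos_sq s
    unfold poissonDenom
    nlinarith [sq_nonneg (1 - r * Real.cos s)]
  have h3 : |8 * r ^ 2 * Real.sin s ^ 2 / poissonDenom r s ^ 3 -
      2 * r * Real.cos s / poissonDenom r s ^ 2| ≤ 10 / poissonDenom r s ^ 2 := by
    have a1 : |8 * r ^ 2 * Real.sin s ^ 2 / poissonDenom r s ^ 3| ≤ 8 / poissonDenom r s ^ 2 := by
      rw [abs_of_nonneg (by positivity), div_le_div_iff₀ (by positivity) (by positivity)]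
      nlinarith [mul_le_mul_of_nonneg_right hsin (pow_pos hD 2).le]
    have a2 : |2 * r * Real.cos s / poissonDenom r s ^ 2| ≤ 2 / poissonDenom r s ^ 2 := by
      rw [abs_div, abs_of_pos (pow_pos hD 2)]
      gcongr
      rw [abs_mul, abs_of_nonneg (by positivity)]
      nlinarith [Real.abs_cos_le_one s, abs_nonneg (Real.cos s)]
    calc _ ≤ _ := abs_sub _ _
      _ ≤ 8 / poissonDenom r s ^ 2 + 2 / poissonDenom r s ^ 2 := add_le_add a1 a2
      _ = _ := by ring
  unfold poissonDeriv₂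
  rw [abs_mul, abs_of_nonneg (by nlinarith)]
  calc (1 - r ^ 2) * _ ≤ (2 * (1 - r)) * (10 / poissonDenom r s ^ 2) := by
        exact mul_le_mul (by nlinarith [sq_nonneg (1 - r)]) h3 (abs_nonneg _) (by linarith)
    _ ≤ 2 * (1 - r) * (10 / (((1 - r) ^ 2 + s ^ 2) / 41) ^ 2) := by
        have : 0 ≤ 1 - r := by linarith
        gcongr
        linarith
    _ = 33620 * (1 - r) / ((1 - r) ^ 2 + s ^ 2) ^ 2 := by field_simp; ring
    _ ≤ _ := by
        have : 0 ≤ 1 - r := by linarith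
        gcongr
        norm_num

theorem poissonDeriv_neg (r s : ℝ) : poissonDeriv r (-s) = -poissonDeriv r s := by
  simp [poissonDeriv, poissonDenom, neg_div]

theorem poissonDeriv_pi (r : ℝ) : poissonDeriv r Real.pi = 0 := by simp [poissonDeriv]

theorem integral_inv_sq_add_sq_le {h : ℝ} (h0 : 0 < h) (b : ℝ) :
    ∫ t in (0 : ℝ)..b, (h ^ 2 + t ^ 2)⁻¹ ≤ Real.pi / (2 * h) := by
  have hd : ∀ t ∈ Set.uIcc 0 b, HasDerivAt (fun t => h⁻¹ * Real.arctan (t / h))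
      (h ^ 2 + t ^ 2)⁻¹ t := by
    intro t _
    have := ((Real.hasDerivAt_arctan (t / h)).comp t ((hasDerivAt_id t).div_const h)).const_mul h⁻¹
    convert! this using 1
    have : h ^ 2 + t ^ 2 ≠ 0 := by positivity
    field_simp
  have hc : Continuous fun t : ℝ => (h ^ 2 + t ^ 2)⁻¹ :=
    Continuous.inv₀ (by fun_prop) fun t => by positivity
  rw [intervalIntegral.integral_eq_sub_of_hasDerivAt hd (hc.intervalIntegrable _ _)]
  have := (Real.arctan_lt_pi_div_two (b / h)).le
  simp only [zero_div, Real.arctan_zero, mul_zero, sub_zero]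
  calc h⁻¹ * Real.arctan (b / h) ≤ h⁻¹ * (Real.pi / 2) := by gcongr
    _ = _ := by field_simp

/-- Integrals of the second derivative of the Poisson kernel against functions of moderate
growth. -/
theorem abs_integral_poissonDeriv₂_mul_le {r K : ℝ} (h0 : 0 ≤ r) (h1 : r < 1) {w : ℝ → ℝ}
    (hw : ∀ t ∈ Set.Ioc 0 Real.pi, |w t| ≤ K * (t * (1 + t / (1 - r)))) :
    |∫ t in (0 : ℝ)..Real.pi, poissonDeriv₂ r t * w t| ≤ 160000 * K / (1 - r) := by
  have hh : 0 < 1 - r := by linarith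
  have hK : 0 ≤ K := by
    have := (abs_nonneg _).trans (hw Real.pi ⟨Real.pi_pos, le_rfl⟩)
    have h2 : 0 < Real.pi * (1 + Real.pi / (1 - r)) := by positivity
    exact nonneg_of_mul_nonneg_left this h2
  -- The growth bound is `K t (h + t) / h` with `h = 1 - r`. Its denominator cancels the factor `h`
  -- of the kernel bound, and `t (h + t) ≤ 2 (h² + t²)` leaves the integrand of an arctangent.
  have hb : ∀ t ∈ Set.Ioc 0 Real.pi, ‖poissonDeriv₂ r t * w t‖ ≤
      80000 * K * ((1 - r) ^ 2 + t ^ 2)⁻¹ := by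
    intro t ht
    have ht0 := ht.1
    rw [norm_mul, Real.norm_eq_abs, Real.norm_eq_abs]
    have hE0 : 0 < (1 - r) ^ 2 + t ^ 2 := by positivity
    calc _ ≤ (40000 * (1 - r) / ((1 - r) ^ 2 + t ^ 2) ^ 2) * (K * (t * (1 + t / (1 - r)))) := by
          gcongr
          · exact abs_poissonDeriv₂_le h0 h1 (by rw [abs_of_pos ht0]; exact ht.2)
          · exact hw t ht
      _ = 40000 * K * (t * ((1 - r) + t)) / ((1 - r) ^ 2 + t ^ 2) ^ 2 := by
          field_simp
      _ ≤ 40000 * K * (2 * ((1 - r) ^ 2 + t ^ 2)) / ((1 - r) ^ 2 + t ^ 2) ^ 2 := by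
          apply div_le_div_of_nonneg_right _ (by positivity)
          apply mul_le_mul_of_nonneg_left _ (by positivity)
          nlinarith [sq_nonneg (1 - r - t), sq_nonneg (1 - r)]
      _ = _ := by field_simp; ring
  have hc : Continuous fun t : ℝ => ((1 - r) ^ 2 + t ^ 2)⁻¹ :=
    Continuous.inv₀ (by fun_prop) fun t => by positivity
  calc _ ≤ ∫ t in (0 : ℝ)..Real.pi, 80000 * K * ((1 - r) ^ 2 + t ^ 2)⁻¹ :=
        intervalIntegral.norm_integral_le_of_norm_le Real.pi_pos.le
          (Filter.Eventually.of_forall fun t ht => hb t ht)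
          ((hc.const_mul _).intervalIntegrable _ _)
    _ ≤ 80000 * K * (Real.pi / (2 * (1 - r))) := by
        rw [intervalIntegral.integral_const_mul]
        gcongr
        exact integral_inv_sq_add_sq_le hh _
    _ ≤ 80000 * K * (4 / (2 * (1 - r))) := by
        gcongr
        exact Real.pi_le_four
    _ = _ := by field_simp; ring

/-! ### The Herglotz integral -/

/-- The Herglotz integral of `μ`. -/
def herglotz (μ : Measure Torus) (z : ℂ) : ℂ :=
  ∫ θ : Torus, ((AddCircle.toCircle θ : ℂ) + z) / ((AddCircle.toCircle θ : ℂ) - z) ∂μ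

/-- The derivative of the Herglotz integral of `μ`. -/
def herglotzDeriv (μ : Measure Torus) (z : ℂ) : ℂ :=
  ∫ θ : Torus, 2 * (AddCircle.toCircle θ : ℂ) / ((AddCircle.toCircle θ : ℂ) - z) ^ 2 ∂μ

theorem le_norm_toCircle_sub (θ : Torus) (z : ℂ) :
    1 - ‖z‖ ≤ ‖(AddCircle.toCircle θ : ℂ) - z‖ := by
  have := norm_sub_norm_le (AddCircle.toCircle θ : ℂ) z
  rwa [Circle.norm_coe] at this

theorem toCircle_sub_ne_zero (θ : Torus) {z : ℂ} (hz : ‖z‖ < 1) :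
    (AddCircle.toCircle θ : ℂ) - z ≠ 0 :=
  norm_pos_iff.1 ((sub_pos.2 hz).trans_le (le_norm_toCircle_sub θ z))

theorem continuous_toCircle_coe : Continuous fun θ : Torus => (AddCircle.toCircle θ : ℂ) :=
  continuous_subtype_val.comp AddCircle.continuous_toCircle

theorem continuous_herglotz_kernel {z : ℂ} (hz : ‖z‖ < 1) : Continuous fun θ : Torus =>
    ((AddCircle.toCircle θ : ℂ) + z) / ((AddCircle.toCircle θ : ℂ) - z) :=
  (continuous_toCircle_coe.add continuous_const).div (continuous_toCircle_coe.sub continuous_const)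
    fun θ => toCircle_sub_ne_zero θ hz

theorem continuous_herglotzDeriv_kernel {z : ℂ} (hz : ‖z‖ < 1) : Continuous fun θ : Torus =>
    2 * (AddCircle.toCircle θ : ℂ) / ((AddCircle.toCircle θ : ℂ) - z) ^ 2 :=
  (continuous_const.mul continuous_toCircle_coe).div
    ((continuous_toCircle_coe.sub continuous_const).pow 2)
    fun θ => pow_ne_zero 2 (toCircle_sub_ne_zero θ hz)

theorem integrable_of_continuous_torus {μ : Measure Torus} [IsFiniteMeasure μ] {f : Torus → ℂ}
    (hf : Continuous f) : Integrable f μ :=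
  hf.integrable_of_hasCompactSupport (HasCompactSupport.of_compactSpace f)

theorem norm_herglotzDeriv_kernel_le (θ : Torus) {z : ℂ} {ρ : ℝ} (hz : ‖z‖ ≤ ρ) (hρ : ρ < 1) :
    ‖2 * (AddCircle.toCircle θ : ℂ) / ((AddCircle.toCircle θ : ℂ) - z) ^ 2‖ ≤
      2 / (1 - ρ) ^ 2 := by
  have := le_norm_toCircle_sub θ z
  have h0 : 0 < 1 - ρ := by linarith
  rw [norm_div, norm_mul, norm_pow, Circle.norm_coe, Complex.norm_ofNat, mul_one]
  gcongr
  linarith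

theorem norm_herglotzDeriv_le (μ : Measure Torus) [IsFiniteMeasure μ] {z : ℂ} {ρ : ℝ}
    (hz : ‖z‖ ≤ ρ) (hρ : ρ < 1) :
    ‖herglotzDeriv μ z‖ ≤ 2 / (1 - ρ) ^ 2 * μ.real Set.univ :=
  norm_integral_le_of_norm_le_const
    (Filter.Eventually.of_forall fun θ => norm_herglotzDeriv_kernel_le θ hz hρ)

theorem hasDerivAt_herglotz (μ : Measure Torus) [IsFiniteMeasure μ] {z : ℂ} (hz : ‖z‖ < 1) :
    HasDerivAt (herglotz μ) (herglotzDeriv μ z) z := by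
  obtain ⟨ρ, h1, h2⟩ := exists_between hz
  have hs : Metric.ball (0 : ℂ) ρ ∈ nhds z :=
    Metric.isOpen_ball.mem_nhds (by simpa using h1)
  refine (hasDerivAt_integral_of_dominated_loc_of_deriv_le (bound := fun _ => 2 / (1 - ρ) ^ 2)
    (F' := fun z (θ : Torus) =>
      2 * (AddCircle.toCircle θ : ℂ) / ((AddCircle.toCircle θ : ℂ) - z) ^ 2) hs ?_ ?_ ?_ ?_
    (integrable_const _) ?_).2
  · filter_upwards [hs] with w hw
    rw [mem_ball_zero_iff] at hw
    exact (continuous_herglotz_kernel (hw.trans h2)).aestronglyMeasurable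
  · exact integrable_of_continuous_torus (continuous_herglotz_kernel hz)
  · exact (continuous_herglotzDeriv_kernel hz).aestronglyMeasurable
  · refine Filter.Eventually.of_forall fun θ w hw => ?_
    rw [mem_ball_zero_iff] at hw
    exact norm_herglotzDeriv_kernel_le θ hw.le h2
  · refine Filter.Eventually.of_forall fun θ w hw => ?_
    rw [mem_ball_zero_iff] at hw
    have hne := toCircle_sub_ne_zero θ (hw.trans h2)
    have := ((hasDerivAt_id w).const_add (AddCircle.toCircle θ : ℂ)).div
      ((hasDerivAt_id w).const_sub (AddCircle.toCircle θ : ℂ)) hne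
    convert! this using 1
    simp only [id]
    ring

theorem herglotz_re_nonneg (μ : Measure Torus) [IsFiniteMeasure μ] {z : ℂ} (hz : ‖z‖ < 1) :
    0 ≤ (herglotz μ z).re := by
  have hi := integrable_of_continuous_torus (μ := μ) (continuous_herglotz_kernel hz)
  have e : (herglotz μ z).re = ∫ θ : Torus,
      (((AddCircle.toCircle θ : ℂ) + z) / ((AddCircle.toCircle θ : ℂ) - z)).re ∂μ :=
    (integral_re hi).symm
  rw [e]
  refine integral_nonneg fun θ => ?_
  set w := (AddCircle.toCircle θ : ℂ) with hw
  have h1 : w.re ^ 2 + w.im ^ 2 = 1 := by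
    have : ‖w‖ ^ 2 = 1 := by rw [hw, Circle.norm_coe, one_pow]
    rwa [Complex.sq_norm, Complex.normSq_apply, ← pow_two, ← pow_two] at this
  have h2 : z.re ^ 2 + z.im ^ 2 ≤ 1 := by
    have : ‖z‖ ^ 2 ≤ 1 := by nlinarith [norm_nonneg z]
    rwa [Complex.sq_norm, Complex.normSq_apply, ← pow_two, ← pow_two] at this
  simp only [Pi.zero_apply]
  rw [Complex.div_re, ← add_div]
  apply div_nonneg _ (Complex.normSq_nonneg _)
  simp only [Complex.add_re, Complex.sub_re, Complex.add_im, Complex.sub_im]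
  nlinarith

theorem norm_singularInner_le_one (μ : Measure Torus) [IsFiniteMeasure μ] {z : ℂ} (hz : ‖z‖ < 1) :
    ‖singularInner μ z‖ ≤ 1 := by
  have := herglotz_re_nonneg μ hz
  change ‖Complex.exp (-herglotz μ z)‖ ≤ 1
  rw [Complex.norm_exp]
  simpa using this

theorem hasDerivAt_singularInner (μ : Measure Torus) [IsFiniteMeasure μ] {z : ℂ} (hz : ‖z‖ < 1) :
    HasDerivAt (singularInner μ) (singularInner μ z * -herglotzDeriv μ z) z :=
  (hasDerivAt_herglotz μ hz).neg.cexp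

theorem norm_deriv_singularInner_le (μ : Measure Torus) [IsFiniteMeasure μ] {z : ℂ}
    (hz : ‖z‖ < 1) : ‖deriv (singularInner μ) z‖ ≤ ‖herglotzDeriv μ z‖ := by
  rw [(hasDerivAt_singularInner μ hz).deriv, norm_mul, norm_neg]
  exact mul_le_of_le_one_left (norm_nonneg _) (norm_singularInner_le_one μ hz)

/-! ### Angles measured from a base point -/

/-- The representative of `θ - a` in `[-π, π)`. -/
def angleFrom (a : ℝ) (θ : Torus) : ℝ :=
  (AddCircle.equivIco (2 * Real.pi) (a - Real.pi) θ : ℝ) - a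

theorem measurable_angleFrom (a : ℝ) : Measurable (angleFrom a) :=
  (measurable_subtype_coe.comp
    (AddCircle.measurableEquivIco (2 * Real.pi) (a - Real.pi)).measurable).sub_const a

theorem angleFrom_mem (a : ℝ) (θ : Torus) : angleFrom a θ ∈ Set.Ico (-Real.pi) Real.pi := by
  have := (AddCircle.equivIco (2 * Real.pi) (a - Real.pi) θ).2
  unfold angleFrom
  constructor <;> linarith [this.1, this.2]

theorem coe_angleFrom_add (a : ℝ) (θ : Torus) : ((angleFrom a θ + a : ℝ) : Torus) = θ := by
  rw [angleFrom, sub_add_cancel]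
  exact AddCircle.coe_equivIco

theorem angleFrom_coe {a x : ℝ} (hx : x ∈ Set.Ico (a - Real.pi) (a + Real.pi)) :
    angleFrom a (x : Torus) = x - a := by
  rw [angleFrom, AddCircle.equivIco_coe_of_mem]
  constructor <;> linarith [hx.1, hx.2]

theorem arc_eq_preimage {a c t : ℝ} (h1 : a - Real.pi ≤ c) (h2 : c + t ≤ a + Real.pi) :
    arc c t = angleFrom a ⁻¹' Set.Ico (c - a) (c + t - a) := by
  ext θ
  constructor
  · rintro ⟨x, hx, rfl⟩
    rw [Set.mem_preimage, angleFrom_coe ⟨h1.trans hx.1, hx.2.trans_le h2⟩]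
    constructor <;> linarith [hx.1, hx.2]
  · intro h
    refine ⟨angleFrom a θ + a, ?_, coe_angleFrom_add a θ⟩
    constructor <;> linarith [h.1, h.2]

/-- With `w = e^{is}` the expression is `2 r w / (w - r)²`. Multiplying through by the square of the
conjugate of `w - r` makes the denominator `D²`, and `w w̄ = 1` reduces the numerator to `2r (w̄ -
2r + r² w)`. -/
theorem im_mul_herglotzDeriv_kernel {r : ℝ} (h0 : 0 ≤ r) (h1 : r < 1) (a : ℝ) (θ : Torus) :
    ((r * Complex.exp (a * Complex.I)) * (2 * (AddCircle.toCircle θ : ℂ) /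
      ((AddCircle.toCircle θ : ℂ) - r * Complex.exp (a * Complex.I)) ^ 2)).im =
      poissonDeriv r (angleFrom a θ) := by
  set s := angleFrom a θ with hs
  set u := Complex.exp (a * Complex.I) with hu
  have hu0 : u ≠ 0 := Complex.exp_ne_zero _
  have hD := poissonDenom_pos h0 h1 s
  have e : (AddCircle.toCircle θ : ℂ) = (Real.cos s + Real.sin s * Complex.I) * u := by
    rw [← coe_angleFrom_add a θ, ← hs, AddCircle.toCircle_apply_mk, Circle.coe_exp,
      Complex.ofReal_cos, Complex.ofReal_sin, ← Complex.exp_mul_I, hu, ← Complex.exp_add]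
    congr 1
    have := Real.pi_ne_zero
    field_simp
    push_cast
    ring
  have hcs : ((Real.cos s : ℝ) : ℂ) ^ 2 + (Real.sin s : ℂ) ^ 2 = 1 := by
    exact_mod_cast Real.cos_sq_add_sin_sq s
  have hDc : (poissonDenom r s : ℂ) = (Real.cos s + Real.sin s * Complex.I - r) *
      (Real.cos s - Real.sin s * Complex.I - r) := by
    unfold poissonDenom
    push_cast at hcs ⊢
    linear_combination -hcs + Complex.sin s ^ 2 * Complex.I_sq
  have hne : (poissonDenom r s : ℂ) ≠ 0 := by exact_mod_cast hD.ne'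
  have hne1 : (Real.cos s + Real.sin s * Complex.I - r : ℂ) ≠ 0 := by
    intro h; rw [hDc, h, zero_mul] at hne; exact hne rfl
  have key : (r * u) * (2 * (AddCircle.toCircle θ : ℂ) /
      ((AddCircle.toCircle θ : ℂ) - r * u) ^ 2) =
      ((2 * r * (Real.cos s * (1 + r ^ 2) - 2 * r) / poissonDenom r s ^ 2 : ℝ) : ℂ) +
        (poissonDeriv r s : ℝ) * Complex.I := by
    have h1 : (r * u) * (2 * (AddCircle.toCircle θ : ℂ) /
        ((AddCircle.toCircle θ : ℂ) - r * u) ^ 2) =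
        2 * r * (Real.cos s + Real.sin s * Complex.I) /
          (Real.cos s + Real.sin s * Complex.I - r) ^ 2 := by
      rw [e, ← sub_mul]
      field_simp
    have h2 : 2 * r * (Real.cos s + Real.sin s * Complex.I) /
          (Real.cos s + Real.sin s * Complex.I - r) ^ 2 =
        2 * r * ((Real.cos s + Real.sin s * Complex.I) *
          (Real.cos s - Real.sin s * Complex.I - r) ^ 2) / (poissonDenom r s : ℂ) ^ 2 := by
      rw [div_eq_div_iff (pow_ne_zero 2 hne1) (pow_ne_zero 2 hne), hDc]
      ring
    have h3 : (Real.cos s + Real.sin s * Complex.I) *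
          (Real.cos s - Real.sin s * Complex.I - r) ^ 2 =
        ((Real.cos s * (1 + r ^ 2) - 2 * r : ℝ) : ℂ) -
          (Real.sin s * (1 - r ^ 2) : ℝ) * Complex.I := by
      push_cast at hcs ⊢
      have hN : (Complex.cos s + Complex.sin s * Complex.I) *
          (Complex.cos s - Complex.sin s * Complex.I) = 1 := by
        linear_combination hcs - Complex.sin s ^ 2 * Complex.I_sq
      linear_combination
        (Complex.cos s - Complex.sin s * Complex.I - 2 * r) * hN
    rw [h1, h2, h3]
    unfold poissonDeriv
    push_cast
    ring
  rw [key]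
  simp only [Complex.add_im, Complex.ofReal_im, Complex.mul_im, Complex.I_re, Complex.I_im,
    Complex.ofReal_re]
  ring

/-! ### The angular derivative through the second differences of `μ` -/

/-- The sign that a pair of adjacent arcs of length `t` around the angle `0` gives to `s`. -/
def adjacentSign (s t : ℝ) : ℝ :=
  Set.indicator {x : ℝ × ℝ | 0 ≤ x.1 ∧ x.1 < x.2} 1 (s, t) -
    Set.indicator {x : ℝ × ℝ | -x.2 ≤ x.1 ∧ x.1 < 0} 1 (s, t)

theorem abs_adjacentSign_le (s t : ℝ) : |adjacentSign s t| ≤ 2 := by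
  have h : ∀ (A : Set (ℝ × ℝ)) x, A.indicator (1 : ℝ × ℝ → ℝ) x ∈ Set.Icc 0 1 := fun A x =>
    ⟨Set.indicator_nonneg (fun _ _ => zero_le_one) x,
      Set.indicator_le' (fun _ _ => le_rfl) (fun _ _ => zero_le_one) x⟩
  have h1 := h {x : ℝ × ℝ | 0 ≤ x.1 ∧ x.1 < x.2} (s, t)
  have h2 := h {x : ℝ × ℝ | -x.2 ≤ x.1 ∧ x.1 < 0} (s, t)
  unfold adjacentSign
  rw [abs_le]
  constructor <;> linarith [h1.1, h1.2, h2.1, h2.2]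

theorem measurable_adjacentSign : Measurable (Function.uncurry adjacentSign) := by
  have h1 : MeasurableSet {x : ℝ × ℝ | 0 ≤ x.1 ∧ x.1 < x.2} :=
    (measurableSet_le measurable_const measurable_fst).inter
      (measurableSet_lt measurable_fst measurable_snd)
  have h2 : MeasurableSet {x : ℝ × ℝ | -x.2 ≤ x.1 ∧ x.1 < 0} :=
    (measurableSet_le measurable_snd.neg measurable_fst).inter
      (measurableSet_lt measurable_fst measurable_const)
  exact (measurable_one.indicator h1).sub (measurable_one.indicator h2)

/-- The sign is that of `s` once `t` passes `|s|`, and zero before, so only the integral from `|s|`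
to `π` of the second derivative remains. The first derivative vanishes at `π`, and its oddness
merges the cases `s ≥ 0` and `s < 0`. -/
theorem integral_poissonDeriv₂_mul_adjacentSign {r s : ℝ} (h0 : 0 ≤ r) (h1 : r < 1)
    (hs : s ∈ Set.Ico (-Real.pi) Real.pi) :
    ∫ t in (0 : ℝ)..Real.pi, poissonDeriv₂ r t * adjacentSign s t = -poissonDeriv r s := by
  have hc := continuous_poissonDeriv₂ h0 h1
  have ftc : ∀ b, ∫ t in b..Real.pi, poissonDeriv₂ r t = -poissonDeriv r b := by
    intro b
    rw [intervalIntegral.integral_eq_sub_of_hasDerivAt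
      (fun t _ => hasDerivAt_poissonDeriv h0 h1 t) (hc.intervalIntegrable _ _), poissonDeriv_pi,
      zero_sub]
  rw [intervalIntegral.integral_of_le Real.pi_pos.le]
  rcases le_or_gt 0 s with h | h
  · have e : ∀ t ∈ Set.Ioc 0 Real.pi, poissonDeriv₂ r t * adjacentSign s t =
        (Set.Ioi s).indicator (poissonDeriv₂ r) t := by
      intro t ht
      by_cases hst : s < t
      · simp [adjacentSign, Set.indicator, h, hst, not_lt.2 h]
      · simp [adjacentSign, Set.indicator, hst, not_lt.2 h]
    rw [setIntegral_congr_fun measurableSet_Ioc e, setIntegral_indicator measurableSet_Ioi,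
      Set.Ioc_inter_Ioi, max_eq_right h, ← intervalIntegral.integral_of_le hs.2.le, ftc]
  · have e : ∀ t ∈ Set.Ioc 0 Real.pi, poissonDeriv₂ r t * adjacentSign s t =
        (Set.Ici (-s)).indicator (fun t => -poissonDeriv₂ r t) t := by
      intro t ht
      by_cases hst : -t ≤ s
      · have : -s ≤ t := by linarith
        simp [adjacentSign, Set.indicator, h, hst, not_le.2 h, this]
      · have : ¬ -s ≤ t := by intro h; apply hst; linarith
        simp [adjacentSign, Set.indicator, hst, not_le.2 h, this]
    have e2 : Set.Ioc 0 Real.pi ∩ Set.Ici (-s) = Set.Icc (-s) Real.pi := by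
      ext t
      constructor
      · rintro ⟨⟨_, a⟩, b⟩; exact ⟨b, a⟩
      · rintro ⟨a, b⟩; exact ⟨⟨by linarith, b⟩, a⟩
    rw [setIntegral_congr_fun measurableSet_Ioc e, setIntegral_indicator measurableSet_Ici,
      e2, integral_Icc_eq_integral_Ioc, ← intervalIntegral.integral_of_le (by linarith [hs.1]),
      intervalIntegral.integral_neg, ftc, poissonDeriv_neg]
    ring

theorem integral_adjacentSign (μ : Measure Torus) [IsFiniteMeasure μ] (a : ℝ) {t : ℝ}
    (h0 : 0 < t) (h1 : t ≤ Real.pi) :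
    ∫ θ, adjacentSign (angleFrom a θ) t ∂μ = μ.real (arc a t) - μ.real (arc (a - t) t) := by
  have hm := measurable_angleFrom a
  have e1 : arc a t = angleFrom a ⁻¹' Set.Ico 0 t := by
    rw [arc_eq_preimage (a := a)] <;> [congr 2; skip; skip] <;> linarith [Real.pi_pos]
  have e2 : arc (a - t) t = angleFrom a ⁻¹' Set.Ico (-t) 0 := by
    rw [arc_eq_preimage (a := a)] <;> [congr 2; skip; skip] <;> linarith [Real.pi_pos]
  have m1 : MeasurableSet (arc a t) := e1 ▸ hm measurableSet_Ico
  have m2 : MeasurableSet (arc (a - t) t) := e2 ▸ hm measurableSet_Ico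
  have e : (fun θ => adjacentSign (angleFrom a θ) t) =
      fun θ => (arc a t).indicator 1 θ - (arc (a - t) t).indicator 1 θ := by
    rw [e1, e2]; rfl
  rw [e, integral_sub ((integrable_const 1).indicator m1) ((integrable_const 1).indicator m2),
    integral_indicator_one m1, integral_indicator_one m2]

/-- Each kernel value is an integral over half-lengths `t` of arc pairs centred at `a`; exchanging
it with the integral over `μ` produces the differences of `μ` on adjacent arcs. -/
theorem im_mul_herglotzDeriv (μ : Measure Torus) [IsFiniteMeasure μ] {r : ℝ} (h0 : 0 ≤ r)
    (h1 : r < 1) (a : ℝ) :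
    ((r * Complex.exp (a * Complex.I)) * herglotzDeriv μ (r * Complex.exp (a * Complex.I))).im =
      -∫ t in (0 : ℝ)..Real.pi, poissonDeriv₂ r t *
        (μ.real (arc a t) - μ.real (arc (a - t) t)) := by
  have hz : ‖(r * Complex.exp (a * Complex.I) : ℂ)‖ < 1 := by
    rw [norm_mul, Complex.norm_exp_ofReal_mul_I, mul_one, Complex.norm_real, Real.norm_eq_abs,
      abs_of_nonneg h0]
    exact h1
  have hi := (integrable_of_continuous_torus (μ := μ) (continuous_herglotzDeriv_kernel hz)).const_mul
    (r * Complex.exp (a * Complex.I) : ℂ)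
  have e1 : ((r * Complex.exp (a * Complex.I)) *
      herglotzDeriv μ (r * Complex.exp (a * Complex.I))).im =
      ∫ θ, poissonDeriv r (angleFrom a θ) ∂μ := by
    rw [herglotzDeriv, ← integral_const_mul]
    refine (integral_im hi).symm.trans (integral_congr_ae (Filter.Eventually.of_forall fun θ => ?_))
    exact im_mul_herglotzDeriv_kernel h0 h1 a θ
  have hc := continuous_poissonDeriv₂ h0 h1
  have hint : Integrable (Function.uncurry fun (t : ℝ) (θ : Torus) =>
      poissonDeriv₂ r t * adjacentSign (angleFrom a θ) t)
      ((volume.restrict (Set.uIoc 0 Real.pi)).prod μ) := by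
    have i1 : Integrable (fun x : ℝ × Torus => poissonDeriv₂ r x.1)
        ((volume.restrict (Set.uIoc 0 Real.pi)).prod μ) :=
      Integrable.comp_fst (f := poissonDeriv₂ r)
        (intervalIntegrable_iff.1 (hc.intervalIntegrable 0 Real.pi)) μ
    refine i1.mul_bdd (c := 2) ?_ (Filter.Eventually.of_forall fun x => abs_adjacentSign_le _ _)
    exact (measurable_adjacentSign.comp
      (((measurable_angleFrom a).comp measurable_snd).prodMk measurable_fst)).aestronglyMeasurable
  have e2 := intervalIntegral_integral_swap hint
  have e3 : ∀ θ, ∫ t in (0 : ℝ)..Real.pi, poissonDeriv₂ r t * adjacentSign (angleFrom a θ) t =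
      -poissonDeriv r (angleFrom a θ) := fun θ =>
    integral_poissonDeriv₂_mul_adjacentSign h0 h1 (angleFrom_mem a θ)
  simp_rw [e3, integral_neg, integral_const_mul] at e2
  rw [e1, ← neg_eq_iff_eq_neg, ← e2]
  refine intervalIntegral.integral_congr_ae (Filter.Eventually.of_forall fun t ht => ?_)
  rw [Set.uIoc_of_le Real.pi_pos.le] at ht
  rw [integral_adjacentSign μ a ht.1 ht.2]

/-! ### Measures with a modulus of smoothness `t / √log (e / t)` -/

theorem abs_sub_le_modulusOfSmoothness (μ : Measure Torus) [IsFiniteMeasure μ] (a : ℝ) {t : ℝ}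
    (h0 : 0 < t) (h1 : t ≤ Real.pi) :
    |μ.real (arc a t) - μ.real (arc (a - t) t)| ≤ modulusOfSmoothness μ t := by
  refine le_csSup ⟨μ.real Set.univ, ?_⟩ ⟨a - t, t, h0, le_rfl, h1, ?_⟩
  · rintro d ⟨b, h, _, _, _, rfl⟩
    have u : ∀ A : Set Torus, μ.real A ≤ μ.real Set.univ := fun A =>
      measureReal_mono (Set.subset_univ A)
    rw [abs_le]
    constructor <;>
      linarith [u (arc b h), u (arc (b + h) h), measureReal_nonneg (μ := μ) (s := arc b h),
        measureReal_nonneg (μ := μ) (s := arc (b + h) h)]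
  · rw [sub_add_cancel, abs_sub_comm]

/-- This trades the logarithm at scale `t` for the one at the fixed scale `h`, at the cost of a
factor `1 + t / h`. For `t ≥ 1` the total mass suffices, since `√L(h) ≤ 1 / h ≤ t / h`. -/
theorem abs_sub_le_of_modulusOfSmoothness_le {μ : Measure Torus} [IsFiniteMeasure μ] {C : ℝ}
    (hC : 0 < C) (hμ : ∀ t ∈ Set.Ioo (0 : ℝ) 1,
      modulusOfSmoothness μ t ≤ C * (t / √(Real.log (Real.exp 1 / t)))) (a : ℝ) {h t : ℝ}
    (h0 : 0 < h) (h1 : h ≤ 1) (ht : t ∈ Set.Ioc 0 Real.pi) :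
    |μ.real (arc a t) - μ.real (arc (a - t) t)| ≤
      (C + μ.real Set.univ) / √(logWeight h) * (t * (1 + t / h)) := by
  have ht0 := ht.1
  have hM : 0 ≤ μ.real Set.univ := measureReal_nonneg
  have hL : 0 < √(logWeight h) := Real.sqrt_pos.2 (logWeight_pos h0 h1)
  rw [div_mul_eq_mul_div, le_div_iff₀ hL]
  rcases lt_or_ge t 1 with h2 | h2
  · have hLt : 0 < √(logWeight t) := Real.sqrt_pos.2 (logWeight_pos ht0 h2.le)
    have key := (abs_sub_le_modulusOfSmoothness μ a ht.1 ht.2).trans (hμ t ⟨ht.1, h2⟩)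
    rw [log_exp_one_div ht0] at key
    calc _ ≤ C * (t / √(logWeight t)) * ((1 + t / h) * √(logWeight t)) :=
          mul_le_mul key (sqrt_logWeight_le h0 ht0 h2.le) hL.le (by positivity)
      _ = C * (t * (1 + t / h)) := by field_simp
      _ ≤ _ := by gcongr; linarith
  · have key : |μ.real (arc a t) - μ.real (arc (a - t) t)| ≤ μ.real Set.univ := by
      have u : ∀ A : Set Torus, μ.real A ≤ μ.real Set.univ := fun A =>
        measureReal_mono (Set.subset_univ A)
      rw [abs_le]
      constructor <;>
        linarith [u (arc a t), u (arc (a - t) t), measureReal_nonneg (μ := μ) (s := arc a t),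
          measureReal_nonneg (μ := μ) (s := arc (a - t) t)]
    calc _ ≤ μ.real Set.univ * h⁻¹ :=
          mul_le_mul key (sqrt_logWeight_le_inv h0 h1) hL.le hM
      _ ≤ (C + μ.real Set.univ) * (t * (1 + t / h)) := by
          apply mul_le_mul (by linarith) _ (by positivity) (by positivity)
          have : h⁻¹ ≤ t / h := by rw [div_eq_mul_inv]; exact le_mul_of_one_le_left (by positivity) h2
          nlinarith [div_pos ht0 h0]

/-- The angular derivative of the Poisson integral of a measure with a small modulus of
smoothness. -/
theorem exists_abs_im_mul_herglotzDeriv_le {μ : Measure Torus} [IsFiniteMeasure μ]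
    (hμ : ∃ C : ℝ, 0 < C ∧ ∀ t ∈ Set.Ioo (0 : ℝ) 1,
      modulusOfSmoothness μ t ≤ C * (t / √(Real.log (Real.exp 1 / t)))) :
    ∃ K : ℝ, 0 < K ∧ ∀ z : ℂ, ‖z‖ < 1 →
      |(z * herglotzDeriv μ z).im| ≤ K / ((1 - ‖z‖) * √(logWeight (1 - ‖z‖))) := by
  obtain ⟨C, hC, hμ⟩ := hμ
  refine ⟨160000 * (C + μ.real Set.univ), by positivity, fun z hz => ?_⟩
  have e := Complex.norm_mul_exp_arg_mul_I z
  have key := abs_integral_poissonDeriv₂_mul_le (norm_nonneg z) hz fun t ht =>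
    abs_sub_le_of_modulusOfSmoothness_le hC hμ z.arg (sub_pos.2 hz)
      (by linarith [norm_nonneg z]) ht
  have := im_mul_herglotzDeriv μ (norm_nonneg z) hz z.arg
  rw [e] at this
  rw [this, abs_neg]
  refine key.trans (le_of_eq ?_)
  have : √(logWeight (1 - ‖z‖)) ≠ 0 :=
    (Real.sqrt_pos.2 (logWeight_pos (sub_pos.2 hz) (by linarith [norm_nonneg z]))).ne'
  have : 1 - ‖z‖ ≠ 0 := (sub_pos.2 hz).ne'
  field_simp

/-! ### From the imaginary part to the full derivative -/

/-- Multiplying `F - F(c)` by `i` gives a function with real part at most `2M` that vanishes at the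
centre. Borel–Carathéodory bounds it by `4M` on the circle of radius `R / 2`, and Cauchy's estimate
there gives `8M / R`. -/
theorem norm_deriv_le_of_abs_im_le {F : ℂ → ℂ} {c : ℂ} {R M : ℝ} (hR : 0 < R) (hM : 0 < M)
    (hF : DifferentiableOn ℂ F (Metric.ball c R)) (hb : ∀ w ∈ Metric.ball c R, |(F w).im| ≤ M) :
    ‖deriv F c‖ ≤ 8 * M / R := by
  have hmem : ∀ w ∈ Metric.ball (0 : ℂ) R, c + w ∈ Metric.ball c R := fun w hw => by
    simpa using hw
  set f : ℂ → ℂ := fun w => Complex.I * (F (c + w) - F c) with hf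
  have hfd : DifferentiableOn ℂ f (Metric.ball 0 R) :=
    ((hF.comp (by fun_prop) hmem).sub_const _).const_mul _
  have hre : Set.MapsTo f (Metric.ball 0 R) {z | z.re ≤ 2 * M} := by
    intro w hw
    have h1 := abs_le.1 (hb _ (hmem w hw))
    have h2 := abs_le.1 (hb c (Metric.mem_ball_self hR))
    simp only [hf, Set.mem_ofPred_eq, Complex.mul_re, Complex.I_re, Complex.I_im, Complex.sub_im]
    linarith [h1.1, h2.2]
  have hbc : ∀ w ∈ Metric.sphere (0 : ℂ) (R / 2), ‖f w‖ ≤ 4 * M := by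
    intro w hw
    have hw' : ‖w‖ = R / 2 := by simpa using hw
    have := Complex.borelCaratheodory_zero (by positivity : 0 < 2 * M) hfd hre hR (z := w)
      (by rw [mem_ball_zero_iff]; linarith) (by simp [hf])
    rw [hw'] at this
    refine this.trans (le_of_eq ?_)
    field_simp
    ring
  have hcl : Metric.closedBall (0 : ℂ) (R / 2) ⊆ Metric.ball 0 R :=
    Metric.closedBall_subset_ball (by linarith)
  have hdc : DiffContOnCl ℂ f (Metric.ball 0 (R / 2)) :=
    (hfd.mono (by rwa [closure_ball _ (by positivity)])).diffContOnCl
  have key := Complex.norm_deriv_le_of_forall_mem_sphere_norm_le (by positivity) hdc hbc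
  have hd : deriv f 0 = Complex.I * deriv F c := by
    have h1 : HasDerivAt F (deriv F c) (c + 0) := by
      rw [add_zero]
      exact (hF.differentiableAt (Metric.ball_mem_nhds c hR)).hasDerivAt
    have h2 := (((h1.comp_const_add c 0)).sub_const (F c)).const_mul Complex.I
    exact h2.deriv
  rw [hd, norm_mul, Complex.norm_I, one_mul] at key
  refine key.trans (le_of_eq ?_)
  field_simp
  norm_num

/-- Makes the bound on the imaginary part uniform, up to the factor `3`, on a disc of radius half
the distance to the circle. -/
theorem mul_sqrt_logWeight_le {h x : ℝ} (h0 : 0 < h) (hx : h / 2 ≤ x) (x1 : x ≤ 1) :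
    h * √(logWeight h) ≤ 3 * (x * √(logWeight x)) := by
  have x0 : 0 < x := by linarith
  have hs := Real.sqrt_nonneg (logWeight x)
  calc h * √(logWeight h) ≤ h * ((1 + x / h) * √(logWeight x)) := by
        gcongr
        exact sqrt_logWeight_le h0 x0 x1
    _ = (h + x) * √(logWeight x) := by field_simp
    _ ≤ (3 * x) * √(logWeight x) := by gcongr; linarith
    _ = _ := by ring

theorem hasDerivAt_inv_mul_sqrt_logWeight {s : ℝ} (h0 : 0 ≤ s) (h1 : s < 1) :
    HasDerivAt (fun s => ((1 - s) * √(logWeight (1 - s)))⁻¹)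
      ((√(logWeight (1 - s)) - 1 / (2 * √(logWeight (1 - s)))) /
        ((1 - s) * √(logWeight (1 - s))) ^ 2) s := by
  have hh : 0 < 1 - s := by linarith
  have hl := logWeight_pos hh (by linarith)
  have hsq := Real.sqrt_pos.2 hl
  have e1 : HasDerivAt (fun s : ℝ => 1 - s) (-1) s := (hasDerivAt_id s).const_sub 1
  have e2 : HasDerivAt (fun s => logWeight (1 - s)) (-(1 - s)⁻¹ * -1) s :=
    HasDerivAt.comp (h₂ := logWeight) s (hasDerivAt_logWeight hh.ne') e1
  have := (e1.mul (e2.sqrt hl.ne')).inv (mul_pos hh hsq).ne'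
  convert! this using 1
  simp only [Pi.mul_apply]
  field_simp
  ring

/-- The loss from differentiating the logarithm is `1 / (2√L)`, at most half of `√L` because `L ≥
1`. Hence `2 / (h √L)` can serve as a primitive majorizing `1 / (h² √L)`. -/
theorem le_deriv_inv_mul_sqrt_logWeight {s : ℝ} (h0 : 0 ≤ s) (h1 : s < 1) :
    1 / (2 * ((1 - s) ^ 2 * √(logWeight (1 - s)))) ≤
      (√(logWeight (1 - s)) - 1 / (2 * √(logWeight (1 - s)))) /
        ((1 - s) * √(logWeight (1 - s))) ^ 2 := by
  have hh : 0 < 1 - s := by linarith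
  have hl : 1 ≤ √(logWeight (1 - s)) := Real.one_le_sqrt.2 (one_le_logWeight hh (by linarith))
  generalize √(logWeight (1 - s)) = x at *
  have hx : 0 < x := by linarith
  have : x / 2 ≤ x - 1 / (2 * x) := by
    have : 1 / (2 * x) ≤ x / 2 := by
      rw [div_le_div_iff₀ (by positivity) (by positivity)]
      nlinarith
    linarith
  calc _ = x / 2 / ((1 - s) * x) ^ 2 := by field_simp
    _ ≤ _ := by gcongr

/-- The derivative of the Herglotz integral of a measure with a small modulus of smoothness. -/
theorem exists_norm_herglotzDeriv_le {μ : Measure Torus} [IsFiniteMeasure μ]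
    (hμ : ∃ C : ℝ, 0 < C ∧ ∀ t ∈ Set.Ioo (0 : ℝ) 1,
      modulusOfSmoothness μ t ≤ C * (t / √(Real.log (Real.exp 1 / t)))) :
    ∃ K : ℝ, 0 < K ∧ ∀ z : ℂ, ‖z‖ < 1 →
      ‖herglotzDeriv μ z‖ ≤ K / ((1 - ‖z‖) * √(logWeight (1 - ‖z‖))) := by
  obtain ⟨K, hK, him⟩ := exists_abs_im_mul_herglotzDeriv_le hμ
  set G : ℂ → ℂ := fun z => z * herglotzDeriv μ z with hG
  have hpos : ∀ z : ℂ, ‖z‖ < 1 → 0 < (1 - ‖z‖) * √(logWeight (1 - ‖z‖)) := fun z hz =>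
    mul_pos (sub_pos.2 hz) (Real.sqrt_pos.2 (logWeight_pos (sub_pos.2 hz)
      (by linarith [norm_nonneg z])))
  have hGd : DifferentiableOn ℂ G (Metric.ball 0 1) := by
    have h1 : DifferentiableOn ℂ (herglotz μ) (Metric.ball 0 1) := fun z hz =>
      (hasDerivAt_herglotz μ (by simpa using hz)).differentiableAt.differentiableWithinAt
    exact differentiableOn_id.mul ((h1.deriv Metric.isOpen_ball).congr fun z hz =>
      (hasDerivAt_herglotz μ (by simpa using hz)).deriv.symm)
  have hG' : ∀ z : ℂ, ‖z‖ < 1 →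
      ‖deriv G z‖ ≤ 48 * K / ((1 - ‖z‖) ^ 2 * √(logWeight (1 - ‖z‖))) := by
    intro z hz
    have hh : 0 < 1 - ‖z‖ := sub_pos.2 hz
    have hnorm : ∀ w ∈ Metric.ball z ((1 - ‖z‖) / 2), (1 - ‖z‖) / 2 ≤ 1 - ‖w‖ := by
      intro w hw
      rw [mem_ball_iff_norm] at hw
      linarith [norm_sub_norm_le w z]
    have hsub : Metric.ball z ((1 - ‖z‖) / 2) ⊆ Metric.ball 0 1 := by
      intro w hw
      rw [mem_ball_zero_iff]
      linarith [hnorm w hw]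
    have hp := hpos z hz
    have := norm_deriv_le_of_abs_im_le (F := G) (c := z) (half_pos hh)
      (M := 3 * K / ((1 - ‖z‖) * √(logWeight (1 - ‖z‖)))) (by positivity) (hGd.mono hsub) ?_
    · refine this.trans (le_of_eq ?_)
      have : √(logWeight (1 - ‖z‖)) ≠ 0 := fun h => by rw [h, mul_zero] at hp; exact hp.false
      field_simp
      norm_num
    · intro w hw
      have hw1 : ‖w‖ < 1 := by simpa using hsub hw
      have h3 := mul_sqrt_logWeight_le hh (hnorm w hw) (by linarith [norm_nonneg w])
      refine (him w hw1).trans ?_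
      rw [div_le_div_iff₀ (hpos w hw1) hp]
      nlinarith
  -- `G` vanishes at the origin, so comparing it along the radius with a multiple of `1 / (h √L)`
  -- integrates the bound on `G'`; the constant doubles from `48` to `96`.
  have hGb : ∀ z : ℂ, ‖z‖ < 1 →
      ‖G z‖ ≤ 96 * K / ((1 - ‖z‖) * √(logWeight (1 - ‖z‖))) := by
    intro z hz
    set u := Complex.exp (z.arg * Complex.I) with hu
    have hu1 : ‖u‖ = 1 := Complex.norm_exp_ofReal_mul_I _
    have hn : ∀ s : ℝ, 0 ≤ s → ‖(s * u : ℂ)‖ = s := fun s hs => by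
      rw [norm_mul, hu1, mul_one, Complex.norm_real, Real.norm_eq_abs, abs_of_nonneg hs]
    have hd : ∀ s : ℝ, 0 ≤ s → s < 1 →
        HasDerivAt (fun s : ℝ => G (s * u)) (deriv G (s * u) * u) s := by
      intro s hs hs1
      have h1 : HasDerivAt G (deriv G (s * u)) (s * u) :=
        (hGd.differentiableAt (Metric.isOpen_ball.mem_nhds
          (by rw [mem_ball_zero_iff, hn s hs]; exact hs1))).hasDerivAt
      have h2 : HasDerivAt (fun s : ℝ => (s * u : ℂ)) u s := by
        simpa using (Complex.ofRealCLM.hasDerivAt (x := s)).mul_const u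
      exact h1.comp s h2
    have key := image_norm_le_of_norm_deriv_right_le_deriv_boundary' (a := 0) (b := ‖z‖)
      (f := fun s : ℝ => G (s * u)) (f' := fun s => deriv G (s * u) * u)
      (B := fun s => 96 * K * ((1 - s) * √(logWeight (1 - s)))⁻¹)
      (B' := fun s => 96 * K * ((√(logWeight (1 - s)) - 1 / (2 * √(logWeight (1 - s)))) /
        ((1 - s) * √(logWeight (1 - s))) ^ 2))
      (fun s hs => (hd s hs.1 (hs.2.trans_lt hz)).continuousAt.continuousWithinAt)
      (fun s hs => (hd s hs.1 (hs.2.trans hz)).hasDerivWithinAt)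
      (by simp [hG, logWeight]; positivity)
      (fun s hs => ((hasDerivAt_inv_mul_sqrt_logWeight hs.1
        (hs.2.trans_lt hz)).const_mul _).continuousAt.continuousWithinAt)
      (fun s hs => ((hasDerivAt_inv_mul_sqrt_logWeight hs.1
        (hs.2.trans hz)).const_mul _).hasDerivWithinAt)
      (fun s hs => by
        rw [norm_mul, hu1, mul_one]
        have h1 := hG' (s * u) (by rw [hn s hs.1]; exact hs.2.trans hz)
        rw [hn s hs.1] at h1
        refine h1.trans (le_trans (le_of_eq ?_) (mul_le_mul_of_nonneg_left
          (le_deriv_inv_mul_sqrt_logWeight hs.1 (hs.2.trans hz)) (by positivity)))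
        have hlt := hs.2.trans hz
        have a1 : 1 - s ≠ 0 := by linarith
        have a2 : √(logWeight (1 - s)) ≠ 0 :=
          (Real.sqrt_pos.2 (logWeight_pos (by linarith) (by linarith [hs.1]))).ne'
        field_simp
        norm_num)
      (Set.right_mem_Icc.2 (norm_nonneg z))
    rw [Complex.norm_mul_exp_arg_mul_I] at key
    rw [div_eq_mul_inv]
    exact key
  -- Dividing `G` by `z` costs a factor `2` when `|z| ≥ 1/2`. For `|z| ≤ 1/2` the trivial bound `2 /
  -- (1/2)² = 8` times the mass is used.
  refine ⟨192 * K + 8 * μ.real Set.univ + 1, by positivity, fun z hz => ?_⟩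
  have hp := hpos z hz
  have hM : 0 ≤ μ.real Set.univ := measureReal_nonneg
  rcases le_total ‖z‖ (1 / 2) with h | h
  · have h1 := norm_herglotzDeriv_le μ h (by norm_num)
    have h2 : (1 - ‖z‖) * √(logWeight (1 - ‖z‖)) ≤ 1 := by
      have hh : 0 < 1 - ‖z‖ := sub_pos.2 hz
      calc _ ≤ (1 - ‖z‖) * (1 - ‖z‖)⁻¹ := by
            gcongr
            exact sqrt_logWeight_le_inv hh (by linarith [norm_nonneg z])
        _ = 1 := mul_inv_cancel₀ hh.ne'
    rw [le_div_iff₀ hp]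
    have h3 := norm_nonneg (herglotzDeriv μ z)
    norm_num at h1
    nlinarith
  · have h1 := hGb z hz
    rw [hG, norm_mul, le_div_iff₀ hp] at h1
    rw [le_div_iff₀ hp]
    have h3 := mul_nonneg (norm_nonneg (herglotzDeriv μ z)) hp.le
    nlinarith

/-! ### Derivatives of `(1 + ‖F‖²) ^ q` -/

theorem hasDerivAt_one_add_normSq_rpow (q : ℝ) {F : ℝ → ℂ} {F' : ℂ} {s : ℝ}
    (hF : HasDerivAt F F' s) :
    HasDerivAt (fun s => (1 + ‖F s‖ ^ 2) ^ q)
      (q * (1 + ‖F s‖ ^ 2) ^ (q - 1) * (2 * inner ℝ (F s) F')) s := by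
  have := (hF.norm_sq.const_add 1).rpow_const (p := q) (Or.inl (by positivity))
  convert! this using 1
  ring

theorem hasDerivAt_one_add_normSq_rpow_mul_inner (q : ℝ) {F A : ℝ → ℂ} {F' A' : ℂ} {s : ℝ}
    (hF : HasDerivAt F F' s) (hA : HasDerivAt A A' s) :
    HasDerivAt (fun s => q * (1 + ‖F s‖ ^ 2) ^ (q - 1) * (2 * inner ℝ (F s) (A s)))
      (q * (q - 1) * (1 + ‖F s‖ ^ 2) ^ (q - 2) * (2 * inner ℝ (F s) F') *
        (2 * inner ℝ (F s) (A s)) +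
        q * (1 + ‖F s‖ ^ 2) ^ (q - 1) * (2 * (inner ℝ (F s) A' + inner ℝ F' (A s)))) s := by
  have := ((hasDerivAt_one_add_normSq_rpow (q - 1) hF).const_mul q).mul
    ((hF.inner ℝ hA).const_mul 2)
  convert! this using 1
  rw [show q - 1 - 1 = q - 2 by ring]
  ring

/-- The function `(1 + |f|²) ^ q`. -/
def regPow (q : ℝ) (f : ℂ → ℂ) (z : ℂ) : ℝ := (1 + ‖f z‖ ^ 2) ^ q

/-- The Euler derivative `z f'(z)`. -/
def euler (f : ℂ → ℂ) (z : ℂ) : ℂ := z * deriv f z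

/-- `r ∂ᵣ` of `(1 + |f|²) ^ q`. -/
def regPowRadial (q : ℝ) (f : ℂ → ℂ) (z : ℂ) : ℝ :=
  q * (1 + ‖f z‖ ^ 2) ^ (q - 1) * (2 * inner ℝ (f z) (euler f z))

/-- `∂_θ` of `(1 + |f|²) ^ q`. -/
def regPowAngular (q : ℝ) (f : ℂ → ℂ) (z : ℂ) : ℝ :=
  q * (1 + ‖f z‖ ^ 2) ^ (q - 1) * (2 * inner ℝ (f z) (Complex.I * euler f z))

/-- `(r ∂ᵣ)²` of `(1 + |f|²) ^ q`. -/
def regPowRadial₂ (q : ℝ) (f : ℂ → ℂ) (z : ℂ) : ℝ :=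
  q * (q - 1) * (1 + ‖f z‖ ^ 2) ^ (q - 2) * (2 * inner ℝ (f z) (euler f z)) ^ 2 +
    q * (1 + ‖f z‖ ^ 2) ^ (q - 1) * (2 * (inner ℝ (f z) (euler (euler f) z) + ‖euler f z‖ ^ 2))

/-- `∂_θ²` of `(1 + |f|²) ^ q`. -/
def regPowAngular₂ (q : ℝ) (f : ℂ → ℂ) (z : ℂ) : ℝ :=
  q * (q - 1) * (1 + ‖f z‖ ^ 2) ^ (q - 2) * (2 * inner ℝ (f z) (Complex.I * euler f z)) ^ 2 +
    q * (1 + ‖f z‖ ^ 2) ^ (q - 1) *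
      (2 * (-inner ℝ (f z) (euler (euler f) z) + ‖euler f z‖ ^ 2))

/-- The point with polar coordinates `(r, θ)`. -/
def polarPt (r θ : ℝ) : ℂ := r * Complex.exp (θ * Complex.I)

theorem norm_polarPt {r : ℝ} (h0 : 0 ≤ r) (θ : ℝ) : ‖polarPt r θ‖ = r := by
  rw [polarPt, norm_mul, Complex.norm_exp_ofReal_mul_I, mul_one, Complex.norm_real,
    Real.norm_eq_abs, abs_of_nonneg h0]

theorem continuous_polarPt : Continuous fun x : ℝ × ℝ => polarPt x.1 x.2 := by
  unfold polarPt; fun_prop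

theorem hasDerivAt_polarPt_radial {f : ℂ → ℂ} {r θ : ℝ} (h0 : 0 < r)
    (hf : DifferentiableAt ℂ f (polarPt r θ)) :
    HasDerivAt (fun r => f (polarPt r θ)) (r⁻¹ • euler f (polarPt r θ)) r := by
  have h2 : HasDerivAt (fun s : ℝ => polarPt s θ) (Complex.exp (θ * Complex.I)) r := by
    simpa [polarPt] using (Complex.ofRealCLM.hasDerivAt (x := r)).mul_const
      (Complex.exp (θ * Complex.I))
  have := hf.hasDerivAt.comp r h2
  convert! this using 1
  have : (r : ℂ) ≠ 0 := by exact_mod_cast h0.ne'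
  rw [euler, polarPt, Complex.real_smul, Complex.ofReal_inv]
  field_simp

theorem hasDerivAt_polarPt_angular {f : ℂ → ℂ} {r θ : ℝ}
    (hf : DifferentiableAt ℂ f (polarPt r θ)) :
    HasDerivAt (fun θ => f (polarPt r θ)) (Complex.I * euler f (polarPt r θ)) θ := by
  have h2 : HasDerivAt (fun s : ℝ => polarPt r s) (polarPt r θ * Complex.I) θ := by
    have := (((Complex.ofRealCLM.hasDerivAt (x := θ)).mul_const Complex.I).cexp).const_mul (r : ℂ)
    simpa [polarPt, mul_assoc] using this
  have := hf.hasDerivAt.comp θ h2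
  convert! this using 1
  rw [euler]
  ring

section Disc

variable {f : ℂ → ℂ}

theorem differentiableOn_euler (hf : DifferentiableOn ℂ f (Metric.ball 0 1)) :
    DifferentiableOn ℂ (euler f) (Metric.ball 0 1) :=
  differentiableOn_id.mul (hf.deriv Metric.isOpen_ball)

theorem differentiableAt_polarPt (hf : DifferentiableOn ℂ f (Metric.ball 0 1)) {r : ℝ}
    (h0 : 0 ≤ r) (h1 : r < 1) (θ : ℝ) : DifferentiableAt ℂ f (polarPt r θ) :=
  hf.differentiableAt (Metric.isOpen_ball.mem_nhds (by simpa [norm_polarPt h0] using h1))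

theorem hasDerivAt_regPow_radial (hf : DifferentiableOn ℂ f (Metric.ball 0 1)) (q : ℝ) {r : ℝ}
    (h0 : 0 < r) (h1 : r < 1) (θ : ℝ) :
    HasDerivAt (fun r => regPow q f (polarPt r θ)) (r⁻¹ * regPowRadial q f (polarPt r θ)) r := by
  have := hasDerivAt_one_add_normSq_rpow q
    (hasDerivAt_polarPt_radial h0 (differentiableAt_polarPt hf h0.le h1 θ))
  convert! this using 1
  rw [regPowRadial, inner_smul_right]
  ring

theorem hasDerivAt_regPowRadial (hf : DifferentiableOn ℂ f (Metric.ball 0 1)) (q : ℝ) {r : ℝ}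
    (h0 : 0 < r) (h1 : r < 1) (θ : ℝ) :
    HasDerivAt (fun r => regPowRadial q f (polarPt r θ))
      (r⁻¹ * regPowRadial₂ q f (polarPt r θ)) r := by
  have := hasDerivAt_one_add_normSq_rpow_mul_inner q
    (hasDerivAt_polarPt_radial h0 (differentiableAt_polarPt hf h0.le h1 θ))
    (hasDerivAt_polarPt_radial h0 (differentiableAt_polarPt (differentiableOn_euler hf) h0.le h1 θ))
  convert! this using 1
  rw [regPowRadial₂, inner_smul_right, inner_smul_right, inner_smul_left,
    real_inner_self_eq_norm_sq]
  simp only [conj_trivial]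
  ring

theorem hasDerivAt_regPowAngular (hf : DifferentiableOn ℂ f (Metric.ball 0 1)) (q : ℝ) {r : ℝ}
    (h0 : 0 ≤ r) (h1 : r < 1) (θ : ℝ) :
    HasDerivAt (fun θ => regPowAngular q f (polarPt r θ))
      (regPowAngular₂ q f (polarPt r θ)) θ := by
  have := hasDerivAt_one_add_normSq_rpow_mul_inner q
    (hasDerivAt_polarPt_angular (differentiableAt_polarPt hf h0 h1 θ))
    ((hasDerivAt_polarPt_angular
      (differentiableAt_polarPt (differentiableOn_euler hf) h0 h1 θ)).const_mul Complex.I)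
  convert! this using 1
  rw [regPowAngular₂, real_inner_self_eq_norm_sq, ← mul_assoc Complex.I Complex.I, Complex.I_mul_I,
    neg_one_mul, inner_neg_right, norm_mul, Complex.norm_I]
  ring

/-- The Laplacian of `(1 + |f|²) ^ q`. -/
theorem regPowRadial₂_add_regPowAngular₂_le (f : ℂ → ℂ) {q : ℝ} (hq : 1 ≤ q) (z : ℂ) :
    regPowRadial₂ q f z + regPowAngular₂ q f z ≤
      4 * q ^ 2 * (1 + ‖f z‖ ^ 2) ^ (q - 1) * ‖euler f z‖ ^ 2 := by
  -- `f'` and `i f'` are orthogonal directions of equal length, so the squared inner products add up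
  -- by Pythagoras. The second-order Euler terms of the radial and angular parts cancel, as `f` is
  -- harmonic.
  have hi : inner ℝ (f z) (euler f z) ^ 2 + inner ℝ (f z) (Complex.I * euler f z) ^ 2 =
      ‖f z‖ ^ 2 * ‖euler f z‖ ^ 2 := by
    simp only [Complex.inner, Complex.sq_norm, Complex.normSq_apply, Complex.mul_re, Complex.mul_im,
      Complex.conj_re, Complex.conj_im, Complex.I_re, Complex.I_im]
    ring
  have hG : 0 < 1 + ‖f z‖ ^ 2 := by positivity
  have e : (1 + ‖f z‖ ^ 2) ^ (q - 1) = (1 + ‖f z‖ ^ 2) ^ (q - 2) * (1 + ‖f z‖ ^ 2) := by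
    rw [← Real.rpow_add_one hG.ne']; congr 1; ring
  have hle : (1 + ‖f z‖ ^ 2) ^ (q - 2) * ‖f z‖ ^ 2 ≤ (1 + ‖f z‖ ^ 2) ^ (q - 1) := by
    rw [e]; gcongr; linarith
  calc _ = 4 * (q * (q - 1)) * ((1 + ‖f z‖ ^ 2) ^ (q - 2) * ‖f z‖ ^ 2) * ‖euler f z‖ ^ 2 +
        4 * q * (1 + ‖f z‖ ^ 2) ^ (q - 1) * ‖euler f z‖ ^ 2 := by
        unfold regPowRadial₂ regPowAngular₂
        linear_combination 4 * q * (q - 1) * (1 + ‖f z‖ ^ 2) ^ (q - 2) * hi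
    _ ≤ 4 * (q * (q - 1)) * (1 + ‖f z‖ ^ 2) ^ (q - 1) * ‖euler f z‖ ^ 2 +
        4 * q * (1 + ‖f z‖ ^ 2) ^ (q - 1) * ‖euler f z‖ ^ 2 := by
        have : 0 ≤ q * (q - 1) := mul_nonneg (by linarith) (by linarith)
        gcongr
    _ = _ := by ring

theorem continuousOn_one_add_normSq_rpow (hf : DifferentiableOn ℂ f (Metric.ball 0 1)) (q : ℝ) :
    ContinuousOn (fun z => (1 + ‖f z‖ ^ 2) ^ q) (Metric.ball 0 1) :=
  (continuousOn_const.add (hf.continuousOn.norm.pow 2)).rpow_const fun z _ =>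
    Or.inl (by have : 0 < 1 + ‖f z‖ ^ 2 := by positivity
               exact this.ne')

theorem continuousOn_regPowRadial (hf : DifferentiableOn ℂ f (Metric.ball 0 1)) (q : ℝ) :
    ContinuousOn (regPowRadial q f) (Metric.ball 0 1) :=
  (continuousOn_const.mul (continuousOn_one_add_normSq_rpow hf _)).mul (continuousOn_const.mul
    (hf.continuousOn.inner (𝕜 := ℝ) (differentiableOn_euler hf).continuousOn))

theorem continuousOn_regPowRadial₂ (hf : DifferentiableOn ℂ f (Metric.ball 0 1)) (q : ℝ) :
    ContinuousOn (regPowRadial₂ q f) (Metric.ball 0 1) := by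
  have hA := (differentiableOn_euler hf).continuousOn
  have hB := (differentiableOn_euler (differentiableOn_euler hf)).continuousOn
  exact ((continuousOn_const.mul (continuousOn_one_add_normSq_rpow hf _)).mul
      ((continuousOn_const.mul (hf.continuousOn.inner (𝕜 := ℝ) hA)).pow 2)).add
    ((continuousOn_const.mul (continuousOn_one_add_normSq_rpow hf _)).mul
      (continuousOn_const.mul ((hf.continuousOn.inner (𝕜 := ℝ) hB).add (hA.norm.pow 2))))

theorem continuousOn_regPowAngular₂ (hf : DifferentiableOn ℂ f (Metric.ball 0 1)) (q : ℝ) :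
    ContinuousOn (regPowAngular₂ q f) (Metric.ball 0 1) := by
  have hA := (differentiableOn_euler hf).continuousOn
  have hB := (differentiableOn_euler (differentiableOn_euler hf)).continuousOn
  exact ((continuousOn_const.mul (continuousOn_one_add_normSq_rpow hf _)).mul
      ((continuousOn_const.mul
        (hf.continuousOn.inner (𝕜 := ℝ) (continuousOn_const.mul hA))).pow 2)).add
    ((continuousOn_const.mul (continuousOn_one_add_normSq_rpow hf _)).mul
      (continuousOn_const.mul ((hf.continuousOn.inner (𝕜 := ℝ) hB).neg.add (hA.norm.pow 2))))

/-- The integrand is the angular derivative of a periodic function. Adding it to the radial part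
therefore completes the Laplacian at no cost. -/
theorem integral_regPowAngular₂ (hf : DifferentiableOn ℂ f (Metric.ball 0 1)) (q : ℝ) {r : ℝ}
    (h0 : 0 ≤ r) (h1 : r < 1) :
    ∫ θ in -Real.pi..Real.pi, regPowAngular₂ q f (polarPt r θ) = 0 := by
  have hc : Continuous fun θ => regPowAngular₂ q f (polarPt r θ) :=
    (continuousOn_regPowAngular₂ hf q).comp_continuous
      (continuous_polarPt.comp (Continuous.prodMk_right r)) fun θ => by
        rw [mem_ball_zero_iff, norm_polarPt h0]; exact h1
  rw [intervalIntegral.integral_eq_sub_of_hasDerivAt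
    (fun θ _ => hasDerivAt_regPowAngular hf q h0 h1 θ) (hc.intervalIntegrable _ _)]
  have : polarPt r (-Real.pi) = polarPt r Real.pi := by
    simp [polarPt, Complex.exp_neg]
  rw [this, sub_self]

end Disc

/-! ### Integrals over rectangles -/

section Rectangle

variable {F : ℝ × ℝ → ℝ} {a b c d : ℝ}

theorem integrableOn_rect (hF : ContinuousOn F (Set.Icc a b ×ˢ Set.Icc c d)) :
    IntegrableOn F (Set.Ioc a b ×ˢ Set.Ioc c d) :=
  (hF.integrableOn_compact (isCompact_Icc.prod isCompact_Icc)).mono_set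
    (Set.prod_mono Set.Ioc_subset_Icc_self Set.Ioc_subset_Icc_self)

theorem setIntegral_rect (hab : a ≤ b) (hcd : c ≤ d)
    (hF : ContinuousOn F (Set.Icc a b ×ˢ Set.Icc c d)) :
    ∫ x in Set.Ioc a b ×ˢ Set.Ioc c d, F x = ∫ r in a..b, ∫ θ in c..d, F (r, θ) := by
  have h := integrableOn_rect hF
  rw [intervalIntegral.integral_of_le hab]
  simp_rw [intervalIntegral.integral_of_le hcd]
  exact setIntegral_prod F h

theorem setIntegral_rect_swap (hab : a ≤ b) (hcd : c ≤ d)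
    (hF : ContinuousOn F (Set.Icc a b ×ˢ Set.Icc c d)) :
    ∫ x in Set.Ioc a b ×ˢ Set.Ioc c d, F x = ∫ θ in c..d, ∫ r in a..b, F (r, θ) := by
  have h := integrableOn_rect hF
  rw [setIntegral_rect hab hcd hF, intervalIntegral.integral_of_le hab,
    intervalIntegral.integral_of_le hcd]
  simp_rw [intervalIntegral.integral_of_le hab, intervalIntegral.integral_of_le hcd]
  refine integral_integral_swap (f := fun r θ => F (r, θ)) ?_
  rwa [Measure.prod_restrict]

end Rectangle

/-! ### Radial weights -/

/-- The weight `h⁻¹ log(e / h)^{-q}`. -/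
def critWeight (q h : ℝ) : ℝ := h⁻¹ * logWeight h ^ (-q)

/-- The primitive of `critWeight` that vanishes at `0`. -/
def critPrimitive (q h : ℝ) : ℝ := logWeight h ^ (1 - q) / (q - 1)

theorem critWeight_pos (q : ℝ) {h : ℝ} (h0 : 0 < h) (h1 : h ≤ 1) : 0 < critWeight q h :=
  mul_pos (inv_pos.2 h0) (Real.rpow_pos_of_pos (logWeight_pos h0 h1) _)

theorem critPrimitive_pos {q h : ℝ} (hq : 1 < q) (h0 : 0 < h) (h1 : h ≤ 1) :
    0 < critPrimitive q h :=
  div_pos (Real.rpow_pos_of_pos (logWeight_pos h0 h1) _) (sub_pos.2 hq)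

theorem hasDerivAt_critPrimitive {q h : ℝ} (hq : 1 < q) (h0 : 0 < h) (h1 : h ≤ 1) :
    HasDerivAt (critPrimitive q) (critWeight q h) h := by
  have := ((hasDerivAt_logWeight h0.ne').rpow_const (p := 1 - q)
    (Or.inl (logWeight_pos h0 h1).ne')).div_const (q - 1)
  convert! this using 1
  have : q - 1 ≠ 0 := (sub_pos.2 hq).ne'
  rw [critWeight, show 1 - q - 1 = -q by ring]
  field_simp
  ring

theorem hasDerivAt_critPrimitive_one_sub {q r : ℝ} (hq : 1 < q) (h0 : 0 ≤ r) (h1 : r < 1) :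
    HasDerivAt (fun r => critPrimitive q (1 - r)) (-critWeight q (1 - r)) r := by
  have := (hasDerivAt_critPrimitive hq (sub_pos.2 h1) (by linarith)).comp r
    ((hasDerivAt_id r).const_sub 1)
  convert! this using 1
  ring

theorem continuousOn_critWeight_one_sub (q : ℝ) :
    ContinuousOn (fun r => critWeight q (1 - r)) (Set.Ico 0 1) := by
  have h1 : ContinuousOn (fun r : ℝ => 1 - r) (Set.Ico 0 1) := by fun_prop
  have h2 : ∀ r ∈ Set.Ico (0 : ℝ) 1, 1 - r ≠ 0 := fun r hr => (sub_pos.2 hr.2).ne'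
  exact (h1.inv₀ h2).mul ((continuousOn_const.sub (h1.log h2)).rpow_const fun r hr =>
    Or.inl (logWeight_pos (sub_pos.2 hr.2) (by linarith [hr.1])).ne')

theorem critPrimitive_mono {q h k : ℝ} (hq : 1 < q) (h0 : 0 < h) (hk : h ≤ k) (k1 : k ≤ 1) :
    critPrimitive q h ≤ critPrimitive q k := by
  unfold critPrimitive
  have : 0 < q - 1 := sub_pos.2 hq
  gcongr ?_ / _
  exact Real.rpow_le_rpow_of_nonpos (logWeight_pos (h0.trans_le hk) k1) (logWeight_anti h0 hk)
    (by linarith)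

/-- The iterated primitive of `critWeight`, with respect to `log r`, that vanishes at `R`. -/
def critPrimitive₂ (q R r : ℝ) : ℝ := ∫ s in r..R, s⁻¹ * critPrimitive q (1 - s)

section Primitive

variable {q R : ℝ}

theorem continuousOn_inv_mul_critPrimitive (hq : 1 < q) :
    ContinuousOn (fun s => s⁻¹ * critPrimitive q (1 - s)) (Set.Ioo 0 1) := fun _ hs =>
  ((continuousAt_inv₀ hs.1.ne').mul
    (hasDerivAt_critPrimitive_one_sub hq hs.1.le hs.2).continuousAt).continuousWithinAt

theorem hasDerivAt_critPrimitive₂ (hq : 1 < q) (hR0 : 0 < R) (hR : R < 1) {r : ℝ} (h0 : 0 < r)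
    (h1 : r < 1) :
    HasDerivAt (critPrimitive₂ q R) (-(r⁻¹ * critPrimitive q (1 - r))) r := by
  have hc := continuousOn_inv_mul_critPrimitive hq
  refine intervalIntegral.integral_hasDerivAt_left ?_ ?_ ?_
  · refine (hc.mono fun s hs => ?_).intervalIntegrable
    exact ⟨(lt_min h0 hR0).trans_le hs.1, hs.2.trans_lt (max_lt h1 hR)⟩
  · exact hc.stronglyMeasurableAtFilter isOpen_Ioo r ⟨h0, h1⟩
  · exact hc.continuousAt (Ioo_mem_nhds h0 h1)

theorem critPrimitive₂_nonneg (hq : 1 < q) (hR : R < 1) {r : ℝ} (h0 : 0 < r) (h1 : r ≤ R) :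
    0 ≤ critPrimitive₂ q R r := by
  refine intervalIntegral.integral_nonneg h1 fun s hs => ?_
  have hs0 := h0.trans_le hs.1
  exact mul_nonneg (inv_nonneg.2 hs0.le)
    (critPrimitive_pos hq (by linarith [hs.2]) (by linarith)).le

/-- The integrand is at most `2 critPrimitive q (1 - r)` by monotonicity and `s ≥ 1/2`, on an
interval of length at most `1 - r`. The bound does not depend on `R`. -/
theorem critPrimitive₂_le (hq : 1 < q) (hR : R < 1) {r : ℝ} (h0 : 1 / 2 ≤ r) (h1 : r ≤ R) :
    critPrimitive₂ q R r ≤ 2 * ((1 - r) * critPrimitive q (1 - r)) := by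
  have hV := critPrimitive_pos hq (h := 1 - r) (by linarith) (by linarith)
  have := intervalIntegral.norm_integral_le_of_norm_le_const (a := r) (b := R)
    (f := fun s => s⁻¹ * critPrimitive q (1 - s)) (C := 2 * critPrimitive q (1 - r)) fun s hs => by
      rw [Set.uIoc_of_le h1] at hs
      have hs0 : 1 / 2 < s := h0.trans_lt hs.1
      have hVs := critPrimitive_pos hq (h := 1 - s) (by linarith [hs.2]) (by linarith)
      rw [Real.norm_eq_abs, abs_of_nonneg (by positivity)]
      apply mul_le_mul _ (critPrimitive_mono hq (by linarith [hs.2]) (by linarith [hs.1])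
        (by linarith)) hVs.le zero_le_two
      rw [inv_le_comm₀ (by linarith) two_pos]
      linarith
  calc _ ≤ _ := le_abs_self _
    _ ≤ _ := this
    _ ≤ _ := by
      rw [abs_of_nonneg (by linarith)]
      nlinarith

end Primitive

/-- Either `c b ≤ a / 2`, and the first summand suffices, or `a < 2 c b`, and the second one does.
The coefficient `1/2` is what allows absorption later. -/
theorem rpow_sub_one_mul_le {q a b c : ℝ} (hq : 1 < q) (ha : 0 < a) (hb : 0 ≤ b) (hc : 0 < c) :
    c * (a ^ (q - 1) * b) ≤ 1 / 2 * a ^ q + (2 * c) ^ q * b ^ q := by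
  have e : ∀ x : ℝ, 0 < x → x ^ q = x ^ (q - 1) * x := fun x hx => by
    rw [← Real.rpow_add_one hx.ne']; congr 1; ring
  have hp := Real.rpow_pos_of_pos ha (q - 1)
  have hbq : 0 ≤ (2 * c) ^ q * b ^ q := by positivity
  rcases le_or_gt (c * b) (a / 2) with h | h
  · rw [e a ha]
    nlinarith
  · have hb0 : 0 < b := pos_of_mul_pos_right ((half_pos ha).trans h) hc.le
    have h2 : a ^ (q - 1) ≤ (2 * c * b) ^ (q - 1) :=
      Real.rpow_le_rpow ha.le (by linarith) (by linarith)
    rw [← Real.mul_rpow (by positivity) hb, e _ (by positivity : 0 < 2 * c * b)]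
    have haq : 0 ≤ a ^ q := by positivity
    have h3 := mul_le_mul_of_nonneg_right h2 (mul_pos hc hb0).le
    have h4 : 0 ≤ (2 * c * b) ^ (q - 1) * (c * b) := by positivity
    nlinarith

/-- Young's inequality for the weights of the Laplacian estimate. -/
theorem young_critWeight {q h G y c : ℝ} (hq : 1 < q) (h0 : 0 < h) (h1 : h ≤ 1) (hG : 0 < G)
    (hy : 0 ≤ y) (hc : 0 < c) :
    c * (G ^ (q - 1) * y ^ 2 * (h * logWeight h ^ (1 - q))) ≤
      1 / 2 * (G ^ q * critWeight q h) + (2 * c) ^ q * (h ^ (2 * q - 1) * y ^ (2 * q)) := by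
  have hl := logWeight_pos h0 h1
  have hq0 : q ≠ 0 := by linarith
  -- The exponents are chosen so that `a^q` carries exactly `critWeight q h` and `b^q` exactly the
  -- Besov weight `h^(2q-1)`.
  have key := rpow_sub_one_mul_le hq (a := G * (h ^ (-1 / q) * logWeight h ^ (-1 : ℝ)))
    (b := h ^ ((2 * q - 1) / q) * y ^ 2) (by positivity) (by positivity) hc
  have e1 : (G * (h ^ (-1 / q) * logWeight h ^ (-1 : ℝ))) ^ q = G ^ q * critWeight q h := by
    rw [Real.mul_rpow hG.le (by positivity), Real.mul_rpow (by positivity) (by positivity),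
      ← Real.rpow_mul h0.le, ← Real.rpow_mul hl.le, critWeight, ← Real.rpow_neg_one h]
    congr 3 <;> field_simp
  have e2 : (h ^ ((2 * q - 1) / q) * y ^ 2) ^ q = h ^ (2 * q - 1) * y ^ (2 * q) := by
    rw [Real.mul_rpow (by positivity) (by positivity), ← Real.rpow_mul h0.le,
      ← Real.rpow_natCast, ← Real.rpow_mul hy]
    congr 2
    field_simp
  have e3 : (G * (h ^ (-1 / q) * logWeight h ^ (-1 : ℝ))) ^ (q - 1) *
      (h ^ ((2 * q - 1) / q) * y ^ 2) =
      G ^ (q - 1) * y ^ 2 * (h * logWeight h ^ (1 - q)) := by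
    rw [Real.mul_rpow hG.le (by positivity), Real.mul_rpow (by positivity) (by positivity),
      ← Real.rpow_mul h0.le, ← Real.rpow_mul hl.le]
    have : h ^ (-1 / q * (q - 1)) * h ^ ((2 * q - 1) / q) = h := by
      rw [← Real.rpow_add h0]
      conv_rhs => rw [← Real.rpow_one h]
      congr 1
      field_simp
      ring
    rw [show -1 * (q - 1) = 1 - q by ring]
    linear_combination G ^ (q - 1) * y ^ 2 * logWeight h ^ (1 - q) * this
  rwa [e1, e2, e3] at key

/-! ### The Hardy type inequality -/

section Laplacian

variable {f : ℂ → ℂ} {q R : ℝ}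

/-- Two integrations by parts in one primitive: differentiating the right-hand combination, the two
terms with `regPowRadial` cancel. At `R` the iterated primitive vanishes, leaving a nonnegative
term. -/
theorem integral_radial_identity (hf : DifferentiableOn ℂ f (Metric.ball 0 1)) (hq : 1 < q)
    (hR0 : 1 / 2 ≤ R) (hR : R < 1) (θ : ℝ) :
    ∫ r in (1 / 2)..R, (r⁻¹ * critPrimitive₂ q R r * regPowRadial₂ q f (polarPt r θ) -
        regPow q f (polarPt r θ) * critWeight q (1 - r)) =
      regPow q f (polarPt R θ) * critPrimitive q (1 - R) -
        (regPowRadial q f (polarPt (1 / 2) θ) * critPrimitive₂ q R (1 / 2) +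
          regPow q f (polarPt (1 / 2) θ) * critPrimitive q (1 - 1 / 2)) := by
  have hmem : ∀ r ∈ Set.uIcc (1 / 2) R, 0 < r ∧ r < 1 := fun r hr => by
    rw [Set.uIcc_of_le hR0] at hr
    exact ⟨by linarith [hr.1], hr.2.trans_lt hR⟩
  have hpol : ContinuousOn (fun r => polarPt r θ) (Set.uIcc (1 / 2) R) :=
    (continuous_polarPt.comp (Continuous.prodMk_left θ)).continuousOn
  have hball : Set.MapsTo (fun r => polarPt r θ) (Set.uIcc (1 / 2) R) (Metric.ball 0 1) :=
    fun r hr => by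
      rw [mem_ball_zero_iff, norm_polarPt (hmem r hr).1.le]
      exact (hmem r hr).2
  have hU : ContinuousOn (critPrimitive₂ q R) (Set.uIcc (1 / 2) R) := fun r hr =>
    (hasDerivAt_critPrimitive₂ hq (by linarith) hR (hmem r hr).1
      (hmem r hr).2).continuousAt.continuousWithinAt
  have hd : ∀ r ∈ Set.uIcc (1 / 2) R, HasDerivAt
      (fun r => regPowRadial q f (polarPt r θ) * critPrimitive₂ q R r +
        regPow q f (polarPt r θ) * critPrimitive q (1 - r))
      (r⁻¹ * critPrimitive₂ q R r * regPowRadial₂ q f (polarPt r θ) -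
        regPow q f (polarPt r θ) * critWeight q (1 - r)) r := by
    intro r hr
    obtain ⟨h0, h1⟩ := hmem r hr
    have := ((hasDerivAt_regPowRadial hf q h0 h1 θ).mul
      (hasDerivAt_critPrimitive₂ hq (by linarith) hR h0 h1)).add
      ((hasDerivAt_regPow_radial hf q h0 h1 θ).mul
        (hasDerivAt_critPrimitive_one_sub hq h0.le h1))
    convert! this using 1
    ring
  have hc : ContinuousOn (fun r => r⁻¹ * critPrimitive₂ q R r *
      regPowRadial₂ q f (polarPt r θ) - regPow q f (polarPt r θ) * critWeight q (1 - r))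
      (Set.uIcc (1 / 2) R) := by
    refine .sub (.mul (.mul (continuousOn_id.inv₀ fun r hr => (hmem r hr).1.ne') hU) ?_)
      (.mul ?_ ?_)
    · exact (continuousOn_regPowRadial₂ hf q).comp hpol hball
    · exact (continuousOn_one_add_normSq_rpow hf q).comp hpol hball
    · exact (continuousOn_critWeight_one_sub q).mono fun r hr => ⟨(hmem r hr).1.le, (hmem r hr).2⟩
  rw [intervalIntegral.integral_eq_sub_of_hasDerivAt hd hc.intervalIntegrable]
  have : critPrimitive₂ q R R = 0 := intervalIntegral.integral_same
  rw [this]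
  ring

/-- The constant `8q² / (q - 1)` collects the `4q²` of the Laplacian bound, the `2` of
`critPrimitive₂_le` and the `1 / (q - 1)` in `critPrimitive`. -/
theorem laplacian_density_le (f : ℂ → ℂ) (hq : 1 < q) (hR : R < 1) {r : ℝ} (h0 : 1 / 2 ≤ r)
    (h1 : r ≤ R) (θ : ℝ) :
    r⁻¹ * critPrimitive₂ q R r *
        (regPowRadial₂ q f (polarPt r θ) + regPowAngular₂ q f (polarPt r θ)) ≤
      1 / 2 * (regPow q f (polarPt r θ) * critWeight q (1 - r)) +
        (2 * (8 * q ^ 2 / (q - 1))) ^ q *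
          ((1 - r) ^ (2 * q - 1) * ‖deriv f (polarPt r θ)‖ ^ (2 * q)) := by
  have hr0 : 0 < r := by linarith
  have hq1 : 0 < q - 1 := sub_pos.2 hq
  have hU := critPrimitive₂_le hq hR h0 h1
  have hU0 := critPrimitive₂_nonneg hq hR hr0 h1
  have hG : 0 < 1 + ‖f (polarPt r θ)‖ ^ 2 := by positivity
  refine le_trans ?_ (young_critWeight hq (by linarith) (by linarith) hG (norm_nonneg _)
    (by positivity))
  have hA : ‖euler f (polarPt r θ)‖ = r * ‖deriv f (polarPt r θ)‖ := by
    rw [euler, norm_mul, norm_polarPt hr0.le]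
  have hL := regPowRadial₂_add_regPowAngular₂_le f hq.le (polarPt r θ)
  rw [hA] at hL
  set D := ‖deriv f (polarPt r θ)‖
  have hGq : 0 < (1 + ‖f (polarPt r θ)‖ ^ 2) ^ (q - 1) := Real.rpow_pos_of_pos hG _
  calc _ ≤ r⁻¹ * critPrimitive₂ q R r *
        (4 * q ^ 2 * (1 + ‖f (polarPt r θ)‖ ^ 2) ^ (q - 1) * (r * D) ^ 2) := by gcongr
    _ = critPrimitive₂ q R r * r *
        (4 * q ^ 2 * (1 + ‖f (polarPt r θ)‖ ^ 2) ^ (q - 1) * D ^ 2) := by field_simp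
    _ ≤ (2 * ((1 - r) * critPrimitive q (1 - r))) * 1 *
        (4 * q ^ 2 * (1 + ‖f (polarPt r θ)‖ ^ 2) ^ (q - 1) * D ^ 2) := by
        gcongr
        · exact hU0.trans hU
        · linarith
    _ = _ := by
        rw [critPrimitive]
        field_simp
        ring

/-- A Hardy type inequality: the critically weighted integral of `(1 + |f|²) ^ q` is controlled by
the weighted integral of `|f'| ^ (2q)`. -/
theorem exists_setIntegral_regPow_le (hf : DifferentiableOn ℂ f (Metric.ball 0 1)) (hq : 1 < q) :
    ∃ K C : ℝ, 0 ≤ C ∧ ∀ R : ℝ, 1 / 2 ≤ R → R < 1 →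
      ∫ x in Set.Ioc (1 / 2) R ×ˢ Set.Ioc (-Real.pi) Real.pi,
        regPow q f (polarPt x.1 x.2) * critWeight q (1 - x.1) ≤
      K + C * ∫ x in Set.Ioc (1 / 2) R ×ˢ Set.Ioc (-Real.pi) Real.pi,
        (1 - x.1) ^ (2 * q - 1) * ‖deriv f (polarPt x.1 x.2)‖ ^ (2 * q) := by
  have hcircle : ∀ r : ℝ, 0 ≤ r → r < 1 → ∀ {g : ℂ → ℝ}, ContinuousOn g (Metric.ball 0 1) →
      Continuous fun θ => g (polarPt r θ) := fun r h0 h1 g hg =>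
    hg.comp_continuous (continuous_polarPt.comp (Continuous.prodMk_right r)) fun θ => by
      rw [mem_ball_zero_iff, norm_polarPt h0]; exact h1
  have hg := continuousOn_one_add_normSq_rpow hf q
  have hP := continuousOn_regPowRadial hf q
  have hV := critPrimitive_pos hq (h := 1 - 1 / 2) (by norm_num) (by norm_num)
  obtain ⟨K, hK⟩ : ∃ K, ∀ θ ∈ Set.Icc (-Real.pi) Real.pi,
      (|regPowRadial q f (polarPt (1 / 2) θ)| + regPow q f (polarPt (1 / 2) θ)) *
        critPrimitive q (1 - 1 / 2) ≤ K := by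
    have hc : Continuous fun θ => (|regPowRadial q f (polarPt (1 / 2) θ)| +
        regPow q f (polarPt (1 / 2) θ)) * critPrimitive q (1 - 1 / 2) :=
      ((hcircle _ (by norm_num) (by norm_num) hP).abs.add
        (hcircle _ (by norm_num) (by norm_num) hg)).mul continuous_const
    obtain ⟨K, hK⟩ := isCompact_Icc.bddAbove_image hc.continuousOn
    exact ⟨K, fun θ hθ => hK (Set.mem_image_of_mem _ hθ)⟩
  set c : ℝ := (2 * (8 * q ^ 2 / (q - 1))) ^ q with hc
  have hc0 : 0 ≤ c := by
    have : 0 < q - 1 := sub_pos.2 hq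
    positivity
  -- Both constants are doubled by moving half of the left-hand integral across; `2πK` is the
  -- boundary term integrated over the circle.
  refine ⟨4 * Real.pi * K, 2 * c, by positivity, fun R hR0 hR => ?_⟩
  set Q : Set (ℝ × ℝ) := Set.Icc (1 / 2) R ×ˢ Set.Icc (-Real.pi) Real.pi with hQ
  have hpi : -Real.pi ≤ Real.pi := by linarith [Real.pi_pos]
  have hmem : ∀ x ∈ Q, 0 < x.1 ∧ x.1 < 1 := fun x hx =>
    ⟨by linarith [hx.1.1], hx.1.2.trans_lt hR⟩
  have hpol : ContinuousOn (fun x : ℝ × ℝ => polarPt x.1 x.2) Q := continuous_polarPt.continuousOn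
  have hball : Set.MapsTo (fun x : ℝ × ℝ => polarPt x.1 x.2) Q (Metric.ball 0 1) := fun x hx => by
    rw [mem_ball_zero_iff, norm_polarPt (hmem x hx).1.le]
    exact (hmem x hx).2
  have hfst : Set.MapsTo (Prod.fst : ℝ × ℝ → ℝ) Q (Set.Ioo 0 1) := fun x hx => hmem x hx
  have hg2 : ContinuousOn (fun x : ℝ × ℝ => regPow q f (polarPt x.1 x.2)) Q := hg.comp hpol hball
  have hW : ContinuousOn (fun x : ℝ × ℝ => critWeight q (1 - x.1)) Q :=
    (continuousOn_critWeight_one_sub q).comp continuousOn_fst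
      fun x hx => ⟨(hmem x hx).1.le, (hmem x hx).2⟩
  have hu : ContinuousOn (fun x : ℝ × ℝ => x.1⁻¹ * critPrimitive₂ q R x.1) Q := by
    have : ContinuousOn (fun r => r⁻¹ * critPrimitive₂ q R r) (Set.Ioo 0 1) := fun r hr =>
      ((continuousAt_inv₀ hr.1.ne').mul (hasDerivAt_critPrimitive₂ hq (by linarith) hR hr.1
        hr.2).continuousAt).continuousWithinAt
    exact this.comp continuousOn_fst hfst
  have hP1 : ContinuousOn (fun x : ℝ × ℝ => regPowRadial₂ q f (polarPt x.1 x.2)) Q :=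
    (continuousOn_regPowRadial₂ hf q).comp hpol hball
  have hP2 : ContinuousOn (fun x : ℝ × ℝ => regPowAngular₂ q f (polarPt x.1 x.2)) Q :=
    (continuousOn_regPowAngular₂ hf q).comp hpol hball
  have hY : ContinuousOn (fun x : ℝ × ℝ =>
      (1 - x.1) ^ (2 * q - 1) * ‖deriv f (polarPt x.1 x.2)‖ ^ (2 * q)) Q := by
    have h1 : ContinuousOn (fun x : ℝ × ℝ => deriv f (polarPt x.1 x.2)) Q :=
      (hf.deriv Metric.isOpen_ball).continuousOn.comp hpol hball
    exact ((continuousOn_const.sub continuousOn_fst).rpow_const fun x hx =>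
      Or.inl (sub_pos.2 (hmem x hx).2).ne').mul
      (h1.norm.rpow_const fun x _ => Or.inr (by linarith))
  have hgW : ContinuousOn (fun x : ℝ × ℝ =>
      regPow q f (polarPt x.1 x.2) * critWeight q (1 - x.1)) Q := hg2.mul hW
  have hI1 : ContinuousOn (fun x : ℝ × ℝ =>
      x.1⁻¹ * critPrimitive₂ q R x.1 * regPowRadial₂ q f (polarPt x.1 x.2)) Q := hu.mul hP1
  have hI2 : ContinuousOn (fun x : ℝ × ℝ =>
      x.1⁻¹ * critPrimitive₂ q R x.1 * regPowAngular₂ q f (polarPt x.1 x.2)) Q := hu.mul hP2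
  have hI3 : ContinuousOn (fun x : ℝ × ℝ =>
      x.1⁻¹ * critPrimitive₂ q R x.1 * regPowRadial₂ q f (polarPt x.1 x.2) -
        regPow q f (polarPt x.1 x.2) * critWeight q (1 - x.1)) Q := hI1.sub hgW
  set Q' : Set (ℝ × ℝ) := Set.Ioc (1 / 2) R ×ˢ Set.Ioc (-Real.pi) Real.pi
  have hQ'm : MeasurableSet Q' := measurableSet_Ioc.prod measurableSet_Ioc
  have iW := integrableOn_rect hgW
  have i1 := integrableOn_rect hI1
  have i2 := integrableOn_rect hI2
  have iY := integrableOn_rect hY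
  have z2 : ∫ x in Q', x.1⁻¹ * critPrimitive₂ q R x.1 * regPowAngular₂ q f (polarPt x.1 x.2) = 0 := by
    rw [setIntegral_rect hR0 hpi hI2]
    rw [intervalIntegral.integral_congr (g := fun _ => (0 : ℝ)), intervalIntegral.integral_zero]
    intro r hr
    rw [Set.uIcc_of_le hR0] at hr
    simp only
    rw [intervalIntegral.integral_const_mul,
      integral_regPowAngular₂ hf q (by linarith [hr.1]) (hr.2.trans_lt hR), mul_zero]
  -- The term at `R` is dropped by its sign. At `r = 1/2`, `critPrimitive₂ q R (1 / 2)` is at most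
  -- `critPrimitive q (1 / 2)`, so the bound `K` is independent of `R`.
  have hlow : -(2 * Real.pi * K) ≤
      ∫ x in Q', (x.1⁻¹ * critPrimitive₂ q R x.1 * regPowRadial₂ q f (polarPt x.1 x.2) -
        regPow q f (polarPt x.1 x.2) * critWeight q (1 - x.1)) := by
    rw [setIntegral_rect_swap hR0 hpi hI3]
    simp_rw [integral_radial_identity hf hq hR0 hR]
    have hconst : ∫ _ in -Real.pi..Real.pi, -K = -(2 * Real.pi * K) := by
      rw [intervalIntegral.integral_const, smul_eq_mul]; ring
    rw [← hconst]
    have hcont : Continuous fun θ => regPow q f (polarPt R θ) * critPrimitive q (1 - R) -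
        (regPowRadial q f (polarPt (1 / 2) θ) * critPrimitive₂ q R (1 / 2) +
          regPow q f (polarPt (1 / 2) θ) * critPrimitive q (1 - 1 / 2)) :=
      ((hcircle R (by linarith) hR hg).mul continuous_const).sub
        (((hcircle _ (by norm_num) (by norm_num) hP).mul continuous_const).add
          ((hcircle _ (by norm_num) (by norm_num) hg).mul continuous_const))
    refine intervalIntegral.integral_mono_on hpi intervalIntegrable_const
      (hcont.intervalIntegrable _ _) fun θ hθ => ?_
    have h1 := hK θ hθ
    have h2 : 0 ≤ regPow q f (polarPt R θ) * critPrimitive q (1 - R) :=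
      mul_nonneg (by unfold regPow; positivity)
        (critPrimitive_pos hq (by linarith) (by linarith)).le
    have h3 := critPrimitive₂_le hq hR le_rfl hR0
    have h4 := critPrimitive₂_nonneg hq hR (by norm_num : (0 : ℝ) < 1 / 2) hR0
    have h5 : regPowRadial q f (polarPt (1 / 2) θ) * critPrimitive₂ q R (1 / 2) ≤
        |regPowRadial q f (polarPt (1 / 2) θ)| * critPrimitive q (1 - 1 / 2) :=
      mul_le_mul (le_abs_self _) (by linarith) h4 (abs_nonneg _)
    linarith
  have hup : ∫ x in Q', (x.1⁻¹ * critPrimitive₂ q R x.1 * regPowRadial₂ q f (polarPt x.1 x.2) +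
      x.1⁻¹ * critPrimitive₂ q R x.1 * regPowAngular₂ q f (polarPt x.1 x.2)) ≤
      ∫ x in Q', (1 / 2 * (regPow q f (polarPt x.1 x.2) * critWeight q (1 - x.1)) +
        c * ((1 - x.1) ^ (2 * q - 1) * ‖deriv f (polarPt x.1 x.2)‖ ^ (2 * q))) := by
    refine setIntegral_mono_on (i1.add i2) ((iW.const_mul _).add (iY.const_mul _)) hQ'm
      fun x hx => ?_
    rw [← mul_add]
    exact laplacian_density_le f hq hR hx.1.1.le hx.1.2 x.2
  rw [integral_sub i1 iW] at hlow
  rw [integral_add i1 i2, integral_add (iW.const_mul _) (iY.const_mul _), integral_const_mul,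
    integral_const_mul, z2] at hup
  linarith

end Laplacian

/-! ### Polar coordinates on the disc -/

theorem polarCoord_symm_eq_polarPt (x : ℝ × ℝ) :
    Complex.polarCoord.symm x = polarPt x.1 x.2 := by
  rw [Complex.polarCoord_symm_apply, polarPt, Complex.exp_mul_I, Complex.ofReal_cos,
    Complex.ofReal_sin]

theorem setLIntegral_ball_eq_polar (Ψ : ℂ → ENNReal) :
    ∫⁻ z in Metric.ball (0 : ℂ) 1, Ψ z =
      ∫⁻ x in Set.Ioo (0 : ℝ) 1 ×ˢ Set.Ioc (-Real.pi) Real.pi,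
        ENNReal.ofReal x.1 * Ψ (polarPt x.1 x.2) := by
  have hT : polarCoord.target = Set.Ioi (0 : ℝ) ×ˢ Set.Ioo (-Real.pi) Real.pi := rfl
  have hTm : MeasurableSet (Set.Ioi (0 : ℝ) ×ˢ Set.Ioo (-Real.pi) Real.pi) :=
    measurableSet_Ioi.prod measurableSet_Ioo
  rw [← lintegral_indicator measurableSet_ball, ← Complex.lintegral_comp_polarCoord_symm, hT]
  have e : ∀ x ∈ Set.Ioi (0 : ℝ) ×ˢ Set.Ioo (-Real.pi) Real.pi,
      ENNReal.ofReal x.1 • (Metric.ball (0 : ℂ) 1).indicator Ψ (Complex.polarCoord.symm x) =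
        (Set.Iio (1 : ℝ) ×ˢ (Set.univ : Set ℝ)).indicator
          (fun x => ENNReal.ofReal x.1 * Ψ (polarPt x.1 x.2)) x := by
    intro x hx
    have hx0 : 0 < x.1 := hx.1
    rw [polarCoord_symm_eq_polarPt, smul_eq_mul]
    by_cases h : x.1 < 1
    · rw [Set.indicator_of_mem (by rwa [mem_ball_zero_iff, norm_polarPt hx0.le]),
        Set.indicator_of_mem (show x ∈ Set.Iio (1 : ℝ) ×ˢ Set.univ from ⟨h, trivial⟩)]
    · rw [Set.indicator_of_notMem (by rwa [mem_ball_zero_iff, norm_polarPt hx0.le]),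
        Set.indicator_of_notMem (fun h' => h h'.1), mul_zero]
  rw [setLIntegral_congr_fun hTm e, setLIntegral_indicator (measurableSet_Iio.prod .univ)]
  refine setLIntegral_congr ?_
  rw [Set.prod_inter_prod, Set.univ_inter, Set.Iio_inter_Ioi]
  exact Measure.set_prod_ae_eq (Filter.EventuallyEq.refl _ _) Ioo_ae_eq_Ioc

/-- The Jacobian `r` exceeds `1/2` on this region. -/
theorem setLIntegral_polar_le (Ψ : ℂ → ENNReal) {R : ℝ} (hR : R < 1) :
    ∫⁻ x in Set.Ioc (1 / 2) R ×ˢ Set.Ioc (-Real.pi) Real.pi, Ψ (polarPt x.1 x.2) ≤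
      2 * ∫⁻ z in Metric.ball (0 : ℂ) 1, Ψ z := by
  rw [setLIntegral_ball_eq_polar, ← lintegral_const_mul' _ _ (by norm_num)]
  have hm : MeasurableSet (Set.Ioc (1 / 2) R ×ˢ Set.Ioc (-Real.pi) Real.pi) :=
    measurableSet_Ioc.prod measurableSet_Ioc
  refine (setLIntegral_mono' (g := fun x : ℝ × ℝ =>
    2 * (ENNReal.ofReal x.1 * Ψ (polarPt x.1 x.2))) hm fun x hx => ?_).trans
    (lintegral_mono_set (Set.prod_mono (fun r hr => ⟨by linarith [hr.1], hr.2.trans_lt hR⟩)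
      subset_rfl))
  rw [← mul_assoc]
  refine le_mul_of_one_le_left zero_le ?_
  rw [show (2 : ENNReal) = ENNReal.ofReal 2 by simp, ← ENNReal.ofReal_mul zero_le_two,
    ENNReal.one_le_ofReal]
  linarith [hx.1.1]

/-- The Jacobian is at most `1`; monotone convergence along radii increasing to `1` turns bounds
uniform in `R` into one on the whole annulus, and the inner disc is handled by boundedness. -/
theorem setLIntegral_ball_lt_top_of_polar {Ψ : ℂ → ENNReal} {M B : ENNReal} (hM : M ≠ ⊤)
    (hB : B ≠ ⊤) (hΨ : ∀ z : ℂ, ‖z‖ ≤ 1 / 2 → Ψ z ≤ M)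
    (h : ∀ R : ℝ, 1 / 2 ≤ R → R < 1 →
      ∫⁻ x in Set.Ioc (1 / 2) R ×ˢ Set.Ioc (-Real.pi) Real.pi, Ψ (polarPt x.1 x.2) ≤ B) :
    ∫⁻ z in Metric.ball (0 : ℂ) 1, Ψ z < ⊤ := by
  rw [setLIntegral_ball_eq_polar]
  set R : ℕ → ℝ := fun n => 1 - 1 / (n + 2) with hR
  have hR1 : ∀ n, R n < 1 := fun n => sub_lt_self _ (by positivity)
  have hR0 : ∀ n, 1 / 2 ≤ R n := fun n => by
    have : (1 : ℝ) / (n + 2) ≤ 1 / 2 := by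
      apply one_div_le_one_div_of_le two_pos
      have := n.cast_nonneg (α := ℝ)
      linarith
    simp only [hR]; linarith
  have hRm : Monotone R := fun m n hmn => by
    have : (m : ℝ) ≤ n := by exact_mod_cast hmn
    simp only [hR]; gcongr
  set A : ℕ → Set (ℝ × ℝ) := fun n => Set.Ioc (1 / 2) (R n) ×ˢ Set.Ioc (-Real.pi) Real.pi with hA
  set A₀ : Set (ℝ × ℝ) := Set.Ioc 0 (1 / 2) ×ˢ Set.Ioc (-Real.pi) Real.pi with hA₀
  have hsub : Set.Ioo (0 : ℝ) 1 ×ˢ Set.Ioc (-Real.pi) Real.pi ⊆ A₀ ∪ ⋃ n, A n := by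
    rintro x ⟨hx1, hx2⟩
    rcases le_or_gt x.1 (1 / 2) with h1 | h1
    · exact Or.inl ⟨⟨hx1.1, h1⟩, hx2⟩
    · obtain ⟨n, hn⟩ := exists_nat_one_div_lt (sub_pos.2 hx1.2)
      refine Or.inr (Set.mem_iUnion.2 ⟨n, ⟨h1, ?_⟩, hx2⟩)
      have : (1 : ℝ) / (n + 2) ≤ 1 / (n + 1) := by gcongr; norm_num
      simp only [hR]; linarith
  have hA₀m : MeasurableSet A₀ := measurableSet_Ioc.prod measurableSet_Ioc
  have hfst : ∫⁻ x in A₀, ENNReal.ofReal x.1 * Ψ (polarPt x.1 x.2) < ⊤ := by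
    refine (setLIntegral_mono' (g := fun _ => M) hA₀m fun x hx => ?_).trans_lt ?_
    · have h1 : ENNReal.ofReal x.1 ≤ 1 := ENNReal.ofReal_le_one.2 (by linarith [hx.1.2])
      calc _ ≤ 1 * M := mul_le_mul' h1 (hΨ _ (by rw [norm_polarPt hx.1.1.le]; exact hx.1.2))
        _ = M := one_mul M
    · rw [setLIntegral_const, hA₀, Measure.volume_eq_prod, Measure.prod_prod, Real.volume_Ioc,
        Real.volume_Ioc]
      exact ENNReal.mul_lt_top hM.lt_top (ENNReal.mul_lt_top ENNReal.ofReal_lt_top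
        ENNReal.ofReal_lt_top)
  have hsnd : ∫⁻ x in ⋃ n, A n, ENNReal.ofReal x.1 * Ψ (polarPt x.1 x.2) ≤ B := by
    have hdir : Directed (· ⊆ ·) A := (monotone_nat_of_le_succ fun n =>
      Set.prod_mono (Set.Ioc_subset_Ioc_right (hRm n.le_succ)) subset_rfl).directed_le
    rw [setLIntegral_iUnion_of_directed _ hdir]
    refine iSup_le fun n => le_trans (setLIntegral_mono'
      (measurableSet_Ioc.prod measurableSet_Ioc) fun x hx => ?_) (h (R n) (hR0 n) (hR1 n))
    exact mul_le_of_le_one_left zero_le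
      (ENNReal.ofReal_le_one.2 (hx.1.2.trans (hR1 n).le))
  calc _ ≤ _ := lintegral_mono_set hsub
    _ ≤ _ := lintegral_union_le _ _ _
    _ < ⊤ := ENNReal.add_lt_top.2 ⟨hfst, hsnd.trans_lt hB.lt_top⟩

theorem setLIntegral_critWeight_lt_top {f : ℂ → ℂ} {q : ℝ} (hq : 1 < q)
    (hf : DifferentiableOn ℂ f (Metric.ball 0 1))
    (hfin : ∫⁻ z in Metric.ball (0 : ℂ) 1,
      ENNReal.ofReal ((1 - ‖z‖) ^ (2 * q - 1) * ‖deriv f z‖ ^ (2 * q)) ≠ ⊤) :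
    ∫⁻ z in Metric.ball (0 : ℂ) 1,
      ENNReal.ofReal (critWeight q (1 - ‖z‖) * ‖f z‖ ^ (2 * q)) < ⊤ := by
  obtain ⟨K, C, hC, hKC⟩ := exists_setIntegral_regPow_le hf hq
  have hle : ∀ z, ‖z‖ < 1 → critWeight q (1 - ‖z‖) * ‖f z‖ ^ (2 * q) ≤
      regPow q f z * critWeight q (1 - ‖z‖) := by
    intro z hz
    have hw := critWeight_pos q (sub_pos.2 hz) (by linarith [norm_nonneg z])
    rw [mul_comm (critWeight _ _), regPow, Real.rpow_mul (norm_nonneg _), Real.rpow_two]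
    gcongr
    linarith
  have hcont : ContinuousOn (fun z : ℂ => regPow q f z * critWeight q (1 - ‖z‖))
      (Metric.ball 0 1) :=
    (continuousOn_one_add_normSq_rpow hf q).mul ((continuousOn_critWeight_one_sub q).comp
      continuous_norm.continuousOn fun z hz => ⟨norm_nonneg z, by simpa using hz⟩)
  have hsub : Metric.closedBall (0 : ℂ) (1 / 2) ⊆ Metric.ball 0 1 :=
    Metric.closedBall_subset_ball (by norm_num)
  obtain ⟨M, hM⟩ := (isCompact_closedBall (0 : ℂ) (1 / 2)).bddAbove_image (hcont.mono hsub)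
  set I := ∫⁻ z in Metric.ball (0 : ℂ) 1,
    ENNReal.ofReal ((1 - ‖z‖) ^ (2 * q - 1) * ‖deriv f z‖ ^ (2 * q))
  refine setLIntegral_ball_lt_top_of_polar (M := ENNReal.ofReal M)
    (B := ENNReal.ofReal (K + C * (2 * I).toReal)) ENNReal.ofReal_ne_top ENNReal.ofReal_ne_top
    (fun z hz => ENNReal.ofReal_le_ofReal ?_) fun R hR0 hR => ?_
  · exact (hle z (by linarith)).trans
      (hM (Set.mem_image_of_mem _ (by simpa using hz)))
  · set Q : Set (ℝ × ℝ) := Set.Ioc (1 / 2) R ×ˢ Set.Ioc (-Real.pi) Real.pi with hQ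
    have hQm : MeasurableSet Q := measurableSet_Ioc.prod measurableSet_Ioc
    have hQ0 : ∀ x ∈ Q, 0 < x.1 ∧ x.1 < 1 := fun x hx =>
      ⟨by linarith [hx.1.1], hx.1.2.trans_lt hR⟩
    have hmaps : Set.MapsTo (fun x : ℝ × ℝ => polarPt x.1 x.2)
        (Set.Icc (1 / 2) R ×ˢ Set.Icc (-Real.pi) Real.pi) (Metric.ball 0 1) := fun x hx => by
      rw [mem_ball_zero_iff, norm_polarPt (by linarith [hx.1.1])]
      exact hx.1.2.trans_lt hR
    have hint : IntegrableOn (fun x : ℝ × ℝ =>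
        regPow q f (polarPt x.1 x.2) * critWeight q (1 - ‖polarPt x.1 x.2‖)) Q :=
      integrableOn_rect (hcont.comp continuous_polarPt.continuousOn hmaps)
    have hYc : ContinuousOn (fun z : ℂ => (1 - ‖z‖) ^ (2 * q - 1) * ‖deriv f z‖ ^ (2 * q))
        (Metric.ball 0 1) :=
      ((continuousOn_const.sub continuous_norm.continuousOn).rpow_const fun z hz =>
        Or.inl (sub_pos.2 (by simpa using hz)).ne').mul
        ((hf.deriv Metric.isOpen_ball).continuousOn.norm.rpow_const
          fun z _ => Or.inr (by linarith))
    have hYi : IntegrableOn (fun x : ℝ × ℝ => (1 - ‖polarPt x.1 x.2‖) ^ (2 * q - 1) *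
        ‖deriv f (polarPt x.1 x.2)‖ ^ (2 * q)) Q :=
      integrableOn_rect (hYc.comp continuous_polarPt.continuousOn hmaps)
    have hnorm : ∀ x ∈ Q, ‖polarPt x.1 x.2‖ = x.1 := fun x hx => norm_polarPt (hQ0 x hx).1.le _
    have hY : ∫ x in Q, (1 - x.1) ^ (2 * q - 1) * ‖deriv f (polarPt x.1 x.2)‖ ^ (2 * q) ≤
        (2 * I).toReal := by
      have hcongr : ∫ x in Q, (1 - ‖polarPt x.1 x.2‖) ^ (2 * q - 1) *
          ‖deriv f (polarPt x.1 x.2)‖ ^ (2 * q) =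
          ∫ x in Q, (1 - x.1) ^ (2 * q - 1) * ‖deriv f (polarPt x.1 x.2)‖ ^ (2 * q) :=
        setIntegral_congr_fun hQm fun x hx => by simp only [hnorm x hx]
      rw [← hcongr]
      rw [integral_eq_lintegral_of_nonneg_ae _ hYi.aestronglyMeasurable]
      · exact ENNReal.toReal_mono (ENNReal.mul_ne_top (by norm_num) hfin)
          (setLIntegral_polar_le (fun z => ENNReal.ofReal
            ((1 - ‖z‖) ^ (2 * q - 1) * ‖deriv f z‖ ^ (2 * q))) hR)
      · filter_upwards [ae_restrict_mem hQm] with x hx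
        have := (hQ0 x hx).2
        rw [hnorm x hx]
        have : 0 ≤ 1 - x.1 := by linarith
        simp only [Pi.zero_apply]
        positivity
    have hpos : 0 ≤ᵐ[volume.restrict Q] fun x : ℝ × ℝ =>
        regPow q f (polarPt x.1 x.2) * critWeight q (1 - ‖polarPt x.1 x.2‖) := by
      filter_upwards [ae_restrict_mem hQm] with x hx
      rw [hnorm x hx]
      exact mul_nonneg (by unfold regPow; positivity)
        (critWeight_pos q (by linarith [(hQ0 x hx).2]) (by linarith [(hQ0 x hx).1])).le
    calc _ ≤ ∫⁻ x in Q, ENNReal.ofReal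
          (regPow q f (polarPt x.1 x.2) * critWeight q (1 - ‖polarPt x.1 x.2‖)) :=
          setLIntegral_mono' hQm fun x hx => ENNReal.ofReal_le_ofReal
            (hle _ (by rw [hnorm x hx]; exact (hQ0 x hx).2))
      _ = ENNReal.ofReal (∫ x in Q,
          regPow q f (polarPt x.1 x.2) * critWeight q (1 - ‖polarPt x.1 x.2‖)) :=
          (ofReal_integral_eq_lintegral_ofReal hint hpos).symm
      _ = ENNReal.ofReal (∫ x in Q, regPow q f (polarPt x.1 x.2) * critWeight q (1 - x.1)) := by
          congr 1
          exact setIntegral_congr_fun hQm fun x hx => by simp only [hnorm x hx]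
      _ ≤ _ := ENNReal.ofReal_le_ofReal ((hKC R hR0 hR).trans (by gcongr))

/-! ### Multipliers -/

theorem add_rpow_le_two_rpow_mul {a b p : ℝ} (ha : 0 ≤ a) (hb : 0 ≤ b) (hp : 0 ≤ p) :
    (a + b) ^ p ≤ 2 ^ p * (a ^ p + b ^ p) := by
  have key : ∀ x y : ℝ, 0 ≤ x → 0 ≤ y → x ≤ y → (x + y) ^ p ≤ 2 ^ p * (x ^ p + y ^ p) := by
    intro x y hx hy hxy
    calc (x + y) ^ p ≤ (2 * y) ^ p := by gcongr; linarith
      _ = 2 ^ p * y ^ p := Real.mul_rpow zero_le_two hy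
      _ ≤ _ := by gcongr; linarith [Real.rpow_nonneg hx p]
  rcases le_total a b with h | h
  · exact key a b ha hb h
  · rw [add_comm a, add_comm (a ^ p)]
    exact key b a hb ha h

/-- A bounded holomorphic function with
`|S'(z)| ≤ K / ((1 - |z|) √log (e / (1 - |z|)))` multiplies the Besov space `D^p_{p-1}`, `p > 2`. -/
theorem isMultiplier_of_norm_deriv_le {S : ℂ → ℂ} {K p : ℝ} (hp : 2 < p) (hK : 0 < K)
    (hS : DifferentiableOn ℂ S (Metric.ball 0 1)) (hS1 : ∀ z, ‖z‖ < 1 → ‖S z‖ ≤ 1)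
    (hS' : ∀ z, ‖z‖ < 1 → ‖deriv S z‖ ≤ K / ((1 - ‖z‖) * √(logWeight (1 - ‖z‖)))) :
    IsMultiplier (besovSpace p) S := by
  rintro f ⟨hf, hfn⟩
  obtain ⟨q, rfl⟩ : ∃ q, p = 2 * q := ⟨p / 2, by ring⟩
  have hq : 1 < q := by linarith
  refine ⟨hS.mul hf, ?_⟩
  unfold besovNorm at hfn ⊢
  have hfin : ∫⁻ z in Metric.ball (0 : ℂ) 1,
      ENNReal.ofReal ((1 - ‖z‖) ^ (2 * q - 1) * ‖deriv f z‖ ^ (2 * q)) ≠ ⊤ := by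
    intro h
    rw [h, ENNReal.top_rpow_of_pos (by positivity), add_top] at hfn
    exact lt_irrefl _ hfn
  have hw := setLIntegral_critWeight_lt_top hq hf hfin
  refine ENNReal.add_lt_top.2 ⟨ENNReal.ofReal_lt_top,
    ENNReal.rpow_lt_top_of_nonneg (by positivity) (ne_of_lt ?_)⟩
  set c : ℝ := 2 ^ (2 * q) * K ^ (2 * q)
  have hc : 0 ≤ c := by positivity
  calc _ ≤ ∫⁻ z in Metric.ball (0 : ℂ) 1,
        (ENNReal.ofReal c * ENNReal.ofReal (critWeight q (1 - ‖z‖) * ‖f z‖ ^ (2 * q)) +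
          ENNReal.ofReal (2 ^ (2 * q)) *
            ENNReal.ofReal ((1 - ‖z‖) ^ (2 * q - 1) * ‖deriv f z‖ ^ (2 * q))) := by
        refine setLIntegral_mono' measurableSet_ball fun z hz => ?_
        have hz1 : ‖z‖ < 1 := by simpa using hz
        have hh : 0 < 1 - ‖z‖ := sub_pos.2 hz1
        have hl := logWeight_pos hh (by linarith [norm_nonneg z])
        have hcw := critWeight_pos q hh (by linarith [norm_nonneg z])
        rw [← ENNReal.ofReal_mul hc, ← ENNReal.ofReal_mul (by positivity),
          ← ENNReal.ofReal_add (by positivity) (by positivity)]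
        apply ENNReal.ofReal_le_ofReal
        have hmem := Metric.isOpen_ball.mem_nhds hz
        have hd : deriv (fun z => S z * f z) z = deriv S z * f z + S z * deriv f z :=
          deriv_fun_mul (hS.differentiableAt hmem) (hf.differentiableAt hmem)
        have hn : ‖deriv (fun z => S z * f z) z‖ ≤
            K / ((1 - ‖z‖) * √(logWeight (1 - ‖z‖))) * ‖f z‖ + ‖deriv f z‖ := by
          rw [hd]
          refine (norm_add_le _ _).trans (add_le_add ?_ ?_)
          · rw [norm_mul]; gcongr; exact hS' z hz1
          · rw [norm_mul]; exact mul_le_of_le_one_left (norm_nonneg _) (hS1 z hz1)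
        -- The critical weight arises here: `h^(2q-1) / (h √L)^(2q) = h⁻¹ L^(-q)`.
        have e : (1 - ‖z‖) ^ (2 * q - 1) *
            (K / ((1 - ‖z‖) * √(logWeight (1 - ‖z‖))) * ‖f z‖) ^ (2 * q) =
            K ^ (2 * q) * (critWeight q (1 - ‖z‖) * ‖f z‖ ^ (2 * q)) := by
          have e1 : √(logWeight (1 - ‖z‖)) ^ (2 * q) = logWeight (1 - ‖z‖) ^ q := by
            rw [Real.rpow_mul (Real.sqrt_nonneg _), Real.rpow_two, Real.sq_sqrt hl.le]
          rw [Real.mul_rpow (by positivity) (norm_nonneg _), Real.div_rpow hK.le (by positivity),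
            Real.mul_rpow hh.le (Real.sqrt_nonneg _), e1, Real.rpow_sub_one hh.ne', critWeight,
            Real.rpow_neg hl.le]
          have := Real.rpow_pos_of_pos hh (2 * q)
          field_simp
        calc _ ≤ (1 - ‖z‖) ^ (2 * q - 1) * (2 ^ (2 * q) *
              ((K / ((1 - ‖z‖) * √(logWeight (1 - ‖z‖))) * ‖f z‖) ^ (2 * q) +
                ‖deriv f z‖ ^ (2 * q))) := by
              gcongr
              exact (Real.rpow_le_rpow (norm_nonneg _) hn (by linarith)).trans
                (add_rpow_le_two_rpow_mul (by positivity) (norm_nonneg _) (by linarith))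
          _ = _ := by linear_combination 2 ^ (2 * q) * e
    _ = ENNReal.ofReal c * (∫⁻ z in Metric.ball (0 : ℂ) 1,
          ENNReal.ofReal (critWeight q (1 - ‖z‖) * ‖f z‖ ^ (2 * q))) +
        ENNReal.ofReal (2 ^ (2 * q)) * ∫⁻ z in Metric.ball (0 : ℂ) 1,
          ENNReal.ofReal ((1 - ‖z‖) ^ (2 * q - 1) * ‖deriv f z‖ ^ (2 * q)) := by
        -- Measurability of one summand is enough to split the integral. The term with `f'` is
        -- chosen because `deriv f` is measurable for every `f`, whatever its values outside the
        -- disc.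
        have hm : Measurable fun z : ℂ => ENNReal.ofReal (2 ^ (2 * q)) *
            ENNReal.ofReal ((1 - ‖z‖) ^ (2 * q - 1) * ‖deriv f z‖ ^ (2 * q)) := by
          have := measurable_deriv f
          fun_prop
        rw [lintegral_add_right _ hm, lintegral_const_mul' _ _ ENNReal.ofReal_ne_top,
          lintegral_const_mul' _ _ ENNReal.ofReal_ne_top]
    _ < ⊤ := ENNReal.add_lt_top.2 ⟨ENNReal.mul_lt_top ENNReal.ofReal_lt_top hw,
        ENNReal.mul_lt_top ENNReal.ofReal_lt_top hfin.lt_top⟩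

end BesovMultiplier

end

/-! ### Conclusion -/

theorem mainTheorem5 (μ : MeasureTheory.Measure BesovMultiplier.Torus)
    [MeasureTheory.IsFiniteMeasure μ]
    (hsing : MeasureTheory.Measure.MutuallySingular μ MeasureTheory.volume)
    (hsmooth : ∃ C : ℝ, 0 < C ∧ ∀ t ∈ Set.Ioo (0 : ℝ) 1,
      BesovMultiplier.modulusOfSmoothness μ t ≤ C * (t / Real.sqrt (Real.log (Real.exp 1 / t))))
    (p : ℝ) (hp : 2 < p) :
    BesovMultiplier.IsMultiplier (BesovMultiplier.besovSpace p)
      (BesovMultiplier.singularInner μ) := by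
  obtain ⟨K, hK, hbound⟩ := BesovMultiplier.exists_norm_herglotzDeriv_le hsmooth
  exact BesovMultiplier.isMultiplier_of_norm_deriv_le hp hK
    (fun z hz => (BesovMultiplier.hasDerivAt_singularInner μ
      (by simpa using hz)).differentiableAt.differentiableWithinAt)
    (fun z hz => BesovMultiplier.norm_singularInner_le_one μ hz)
    fun z hz => (BesovMultiplier.norm_deriv_singularInner_le μ hz).trans (hbound z hz)
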